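/- **Theorem 3.5.** Let $H$ be a Hopf algebra over a field $k$, with comultiplication $\Delta$ and counit $\varepsilon$, and let $A\neq 0$ be a right $H$-comodule algebra: an associative unital $k$-algebra with a right $H$-comodule structure $\rho_A:A\to A\otimes H$ (tensor products are over $k$) that is a homomorphism of unital algebras. "Ideal" means two-sided ideal, and $\operatorname{Max}A$ is the set of maximal two-sided ideals of $A$. Suppose that - $A$ is semilocal, i.e. the factor ring of $A$ by its Jacobson radical is semisimple Artinian; - $A$ is $H$-simple, i.e. the only ideals $I$ of $A$ with $\rho_A(I)\subseteq I\otimes H$ are $0$ and $A$; - (C) for every $Q\in\operatorname{Max}A$ the ring $R=A/Q\otimes H$ is weakly finite, i.e. for all $n>0$ and all $X,Y\in\operatorname{Mat}_n(R)$, $XY=1$ implies $YX=1$. Let $\mathcal M_A^H$ be the category of right $A$-modules $M$ with a right $H$-comodule structure $\rho_M:M\to M\otimes H$ such that $\rho_M(ma)=\rho_M(m)\rho_A(a)$ for all $m\in M$, $a\in A$, where $A\otimes H$ acts on $M\otimes H$ by $(m\otimes g)(a\otimes h)=ma\otimes gh$. Then every object $M$ of $\mathcal M_A^H$ is a projective right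 $A$-module. Moreover, an object $M$ of $\mathcal M_A^H$ is a free right $A$-module if and only if $M/MQ$ is a free right $A/Q$-module for at least one $Q\in\operatorname{Max}A$. -/

import Mathlib

open scoped TensorProduct

/-- A right comodule over a `k`-coalgebra `C`: a `k`-module `V` with a coassociative and counital
coaction `ρ : V → V ⊗ C`. -/
class RightComodule (k C V : Type*) [CommSemiring k] [AddCommMonoid C] [Module k C]
    [Coalgebra k C] [AddCommMonoid V] [Module k V] where
  /-- the coaction `ρ` -/
  coact : V →ₗ[k] V ⊗[k] C
  /-- `(ρ ⊗ id) ∘ ρ = (id ⊗ Δ) ∘ ρ` -/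
  coassoc : (TensorProduct.assoc k V C C).toLinearMap ∘ₗ coact.rTensor C ∘ₗ coact =
    (Coalgebra.comul (R := k) (A := C)).lTensor V ∘ₗ coact
  /-- `(id ⊗ ε) ∘ ρ = id` -/
  counit_coact : (TensorProduct.rid k V).toLinearMap ∘ₗ
    (Coalgebra.counit (R := k) (A := C)).lTensor V ∘ₗ coact = LinearMap.id

/-- A right `H`-comodule algebra: an algebra with a right `H`-comodule structure such that
`ρ : A → A ⊗ H` is a homomorphism of unital algebras. -/
class ComoduleAlgebra (k H A : Type*) [CommRing k] [Ring H] [HopfAlgebra k H]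
    [Ring A] [Algebra k A] extends RightComodule k H A where
  coact_one : coact 1 = 1
  coact_mul : ∀ a b : A, coact (a * b) = coact a * coact b

/-- The right action of `A ⊗ H` on `M ⊗ H`, for a right `A`-module `M`:
`(m ⊗ g) · (a ⊗ h) = m a ⊗ g h`. A right `A`-module is a module over `Aᵐᵒᵖ`, where
`MulOpposite.op a • m` is `m a`. -/
noncomputable def tensorRightAct (k H A M : Type*) [CommRing k] [Ring H] [Algebra k H]
    [Ring A] [Algebra k A] [AddCommGroup M] [Module k M] [Module Aᵐᵒᵖ M]
    [IsScalarTower k Aᵐᵒᵖ M] : M ⊗[k] H →ₗ[k] A ⊗[k] H →ₗ[k] M ⊗[k] H :=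
  TensorProduct.map₂
    (LinearMap.mk₂ k (fun (m : M) (a : A) => MulOpposite.op a • m)
      (fun m₁ m₂ a => smul_add _ m₁ m₂)
      (fun c m a => smul_comm _ c m)
      (fun m a₁ a₂ => by rw [MulOpposite.op_add, add_smul])
      (fun c m a => by rw [MulOpposite.op_smul, smul_assoc]))
    (LinearMap.mul k H)

/-- The structure of an object of the category `M_A^H` of right `(H, A)`-Hopf modules on a right
`A`-module `M`: a right `H`-comodule structure with `ρ_M (m a) = ρ_M (m) ρ_A (a)`. -/
class RightHopfModule (k H A M : Type*) [CommRing k] [Ring H] [HopfAlgebra k H]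
    [Ring A] [Algebra k A] [ComoduleAlgebra k H A] [AddCommGroup M] [Module k M]
    [Module Aᵐᵒᵖ M] [IsScalarTower k Aᵐᵒᵖ M] extends RightComodule k H M where
  coact_act : ∀ (m : M) (a : A), coact (MulOpposite.op a • m) =
    tensorRightAct k H A M (coact m) (RightComodule.coact (k := k) (C := H) a)

/-- A two-sided ideal `I` of a comodule algebra `A` is `H`-costable if `ρ(I) ⊆ I ⊗ H`, where
`I ⊗ H` is the subspace of `A ⊗ H` spanned by the tensors `b ⊗ h` with `b ∈ I`. -/
def IsCostable (k H : Type*) {A : Type*} [CommRing k] [Ring H] [HopfAlgebra k H]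
    [Ring A] [Algebra k A] [ComoduleAlgebra k H A] (I : TwoSidedIdeal A) : Prop :=
  ∀ a ∈ I, RightComodule.coact (k := k) (C := H) a ∈
    Submodule.span k {x : A ⊗[k] H | ∃ b ∈ I, ∃ h : H, x = b ⊗ₜ[k] h}

/-- `A` is `H`-simple: it has no nonzero proper `H`-costable two-sided ideals. -/
def IsHSimple (k H A : Type*) [CommRing k] [Ring H] [HopfAlgebra k H]
    [Ring A] [Algebra k A] [ComoduleAlgebra k H A] : Prop :=
  ∀ I : TwoSidedIdeal A, IsCostable k H I → I = ⊥ ∨ I = ⊤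

/-- A ring is semilocal if its factor ring by the Jacobson radical is semisimple Artinian. -/
def IsSemilocal (A : Type*) [Ring A] : Prop :=
  IsSemisimpleRing (A ⧸ Ring.jacobson A)

/-- Condition (C): `A/Q ⊗ H` is weakly finite (stably finite) for every maximal two-sided
ideal `Q` of `A`. -/
def ConditionC (k H A : Type*) [CommRing k] [Ring H] [HopfAlgebra k H]
    [Ring A] [Algebra k A] : Prop :=
  ∀ Q : TwoSidedIdeal A, IsCoatom Q →
    IsStablyFiniteRing ((A ⧸ TwoSidedIdeal.asIdeal Q) ⊗[k] H)

/-- For a right `A`-module `M` and a two-sided ideal `Q` of `A`, the right `A/Q`-module `M/MQ` is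
free. Right `A/Q`-modules are modules over the opposite ring `Aᵐᵒᵖ/Qᵐᵒᵖ` of `A/Q`. -/
def IsFreeModulo {A : Type*} [Ring A] (M : Type*) [AddCommGroup M] [Module Aᵐᵒᵖ M]
    (Q : TwoSidedIdeal A) : Prop :=
  Module.Free (Aᵐᵒᵖ ⧸ TwoSidedIdeal.asIdeal Q.op)
    (M ⧸ (TwoSidedIdeal.asIdeal Q.op • ⊤ : Submodule Aᵐᵒᵖ M))

/-! Right `A`-modules are modules over `Aᵐᵒᵖ`. Let `Q` be a maximal ideal and `N` a finitely
generated Hopf module. Following the coaction of `A` by reduction modulo `Q` gives a ring map `A →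
A/Q ⊗ H`. Its kernel is costable, so `H`-simplicity makes it injective
(`coactionReduction_injective`). A linear map `u : N → A/Q` induces `û = (u ⊗ id) ρ : N → A/Q ⊗ H`,
semilinear along this ring map, and the antipode recovers every `u(y) ⊗ h` from values of `û`
(`antipodePairing_coaction`). So a surjection `N^d → (A/Q)^n` yields a semilinear map `N^d → (A/Q ⊗
H)^n` whose image spans. If moreover `N^d` has `n` generators, weak finiteness forces them to be a
basis (`linearIndependent_of_span_eq_top`).

Semilocality supplies such `d`, `n` and `Q`: take `Q` maximising the ratio of the length of `N/NQ`
to that of `A/Q` (`IsSemilocalFamily.exists_surjective_fun`). Hence some power of `N` is free, and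
`N` is projective. The ratio is then the same at all maximal ideals, so if one `N/NQ` is free of
rank `r`, then `r` elements generate `N`, and the basis argument with `d = 1` makes `N` free.

By local finiteness and Zorn's lemma, an arbitrary Hopf module is a direct sum of finitely generated
submodules with free powers (`exists_sSupIndep_hasFreePower`), hence projective. With finitely many
summands the finite case decides freeness. With infinitely many the module is always free, by the
Eilenberg swindle (`IsSemilocalFamily.nonempty_linearEquiv_finsupp`). -/

/-! ### Stable finiteness and bases -/

/-- The images of the `n` generators span `S^n`, so they define a surjective endomorphism of `S^n`,
which is injective by stable finiteness. A relation over `B` is carried by `φ` into its kernel. -/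
theorem linearIndependent_of_semilinear {B S L : Type*} [Ring B] [Ring S] [IsStablyFiniteRing S]
    {φ : B →+* S} (hφ : Function.Injective φ) [AddCommGroup L] [Module B L] {n : ℕ}
    {m : Fin n → L} (hm : Submodule.span B (Set.range m) = ⊤) (f : L →ₛₗ[φ] (Fin n → S))
    (hf : Submodule.span S (Set.range f) = ⊤) : LinearIndependent B m := by
  let g : Module.End S (Fin n → S) := Fintype.linearCombination S (fun i => f (m i))
  have key (b : Fin n → B) : g (fun i => φ (b i)) = f (∑ i, b i • m i) := by
    simp [g, Fintype.linearCombination_apply, map_sum]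
  have hsurj : Function.Surjective g := by
    rw [← LinearMap.range_eq_top, eq_top_iff, ← hf, Submodule.span_le]
    rintro _ ⟨x, rfl⟩
    have hx : x ∈ Submodule.span B (Set.range m) := hm ▸ Submodule.mem_top
    obtain ⟨b, rfl⟩ := (Submodule.mem_span_range_iff_exists_fun B).mp hx
    exact ⟨_, key b⟩
  have hinj := Module.End.injective_of_surjective_fin hsurj
  rw [Fintype.linearIndependent_iff]
  intro b hb i
  have h0 : (fun i => φ (b i)) = 0 := hinj (by rw [key, hb]; simp)
  exact (map_eq_zero_iff φ hφ).mp (congrFun h0 i)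

/-! ### Splittings and the Eilenberg swindle -/

/-- A module with a projective quotient `P` is the direct sum of `P` and the kernel. -/
theorem nonempty_linearEquiv_prod_ker {B M P : Type*} [Ring B] [AddCommGroup M] [Module B M]
    [AddCommGroup P] [Module B P] [Module.Projective B P] (f : M →ₗ[B] P)
    (hf : Function.Surjective f) : Nonempty (M ≃ₗ[B] P × LinearMap.ker f) := by
  obtain ⟨g, hg⟩ := f.exists_rightInverse_of_surjective (LinearMap.range_eq_top.mpr hf)
  have hg' (x : P) : f (g x) = x := LinearMap.congr_fun hg x
  refine ⟨LinearEquiv.ofLinearMap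
    (f.prod ((LinearMap.id - g ∘ₗ f).codRestrict (LinearMap.ker f) fun x => by simp [hg']))
    (g.coprod (LinearMap.ker f).subtype) ?_ ?_⟩
  · ext x <;> simp [hg']
  · ext x; simp

/-- Finitely supported functions with values in a product. -/
noncomputable def finsuppProdEquivProd (B α X Y : Type*) [Semiring B] [AddCommMonoid X] [Module B X]
    [AddCommMonoid Y] [Module B Y] : (α →₀ X × Y) ≃ₗ[B] (α →₀ X) × (α →₀ Y) :=
  LinearEquiv.ofLinearMap
    ((Finsupp.mapRange.linearMap (LinearMap.fst B X Y)).prod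
      (Finsupp.mapRange.linearMap (LinearMap.snd B X Y)))
    ((Finsupp.mapRange.linearMap (LinearMap.inl B X Y)).coprod
      (Finsupp.mapRange.linearMap (LinearMap.inr B X Y)))
    (by ext <;> simp) (by ext <;> simp)

/-- The Eilenberg swindle. -/
theorem nonempty_prod_linearEquiv_of_prod_equiv {B F X Y κ : Type*} [Semiring B] [AddCommMonoid X]
    [Module B X] [AddCommMonoid Y] [Module B Y] [AddCommMonoid F] [Module B F] [Infinite κ]
    (e : F ≃ₗ[B] X × Y) (i : F ≃ₗ[B] (κ →₀ B)) : Nonempty ((F × X) ≃ₗ[B] F) := by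
  obtain ⟨c⟩ : Nonempty (κ ≃ ℕ × κ) :=
    Cardinal.eq.mp (by rw [Cardinal.mk_prod]; simp)
  -- `F` is a direct sum of countably many copies of itself, hence of copies of `X` and of `Y`; the
  -- countable sum of copies of `X` absorbs one more by shifting the index.
  let s : F ≃ₗ[B] (ℕ →₀ F) := i ≪≫ₗ Finsupp.domLCongr c ≪≫ₗ Finsupp.curryLinearEquiv B ≪≫ₗ
    Finsupp.mapRange.linearEquiv i.symm
  let t : F ≃ₗ[B] (ℕ →₀ X) × (ℕ →₀ Y) := s ≪≫ₗ Finsupp.mapRange.linearEquiv e ≪≫ₗ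
    finsuppProdEquivProd B ℕ X Y
  let u : ((ℕ →₀ X) × X) ≃ₗ[B] (ℕ →₀ X) :=
    (LinearEquiv.refl B (ℕ →₀ X)).prodCongr (Finsupp.uniqueLinearEquiv B X ()).symm ≪≫ₗ
      (Finsupp.sumFinsuppLEquivProdFinsupp B).symm ≪≫ₗ
      Finsupp.domLCongr Equiv.natSumPUnitEquivNat
  exact ⟨(t.prodCongr (LinearEquiv.refl B X)) ≪≫ₗ (LinearEquiv.prodAssoc B _ _ _) ≪≫ₗ
    (LinearEquiv.refl B _).prodCongr (LinearEquiv.prodComm B _ _) ≪≫ₗ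
    (LinearEquiv.prodAssoc B _ _ _).symm ≪≫ₗ
    u.prodCongr (LinearEquiv.refl B _) ≪≫ₗ t.symm⟩

/-- A projective module which is both an image of a free module `F` of infinite rank and maps
onto `F` is isomorphic to `F`, by the Eilenberg swindle. -/
theorem nonempty_linearEquiv_finsupp_of_surjective {B M κ : Type*} [Ring B] [AddCommGroup M]
    [Module B M] [Module.Projective B M] [Infinite κ] (p : (κ →₀ B) →ₗ[B] M)
    (hp : Function.Surjective p) (q : M →ₗ[B] (κ →₀ B)) (hq : Function.Surjective q) :
    Nonempty (M ≃ₗ[B] (κ →₀ B)) := by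
  obtain ⟨e⟩ := nonempty_linearEquiv_prod_ker q hq
  have : Module.Projective B (LinearMap.ker q) :=
    Module.Projective.of_split (R := B) (M := M) (P := LinearMap.ker q)
      (e.symm.toLinearMap ∘ₗ LinearMap.inr B (κ →₀ B) (LinearMap.ker q))
      (LinearMap.snd B (κ →₀ B) (LinearMap.ker q) ∘ₗ e.toLinearMap) (by ext; simp)
  -- The composite of `p` with the projection of `M` to `ker q` splits, so `ker q` is a direct
  -- summand of the free module and the swindle absorbs it.
  obtain ⟨e'⟩ := nonempty_linearEquiv_prod_ker
    (LinearMap.snd B (κ →₀ B) (LinearMap.ker q) ∘ₗ e.toLinearMap ∘ₗ p)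
    ((LinearMap.snd_surjective (R := B)).comp (e.surjective.comp hp))
  obtain ⟨e''⟩ := nonempty_prod_linearEquiv_of_prod_equiv e' (LinearEquiv.refl B _)
  exact ⟨e ≪≫ₗ e''⟩

/-! ### Semilocal families and reduction modulo an ideal -/

/-- A family of two-sided ideals with simple Artinian quotients which presents the quotient of a
ring `B` by an ideal contained in its Jacobson radical as a direct product. -/
structure IsSemilocalFamily {B ι : Type*} [Ring B] (P : ι → TwoSidedIdeal B) : Prop where
  isSimpleRing : ∀ i, IsSimpleRing (B ⧸ (P i).asIdeal)
  isArtinianRing : ∀ i, IsArtinianRing (B ⧸ (P i).asIdeal)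
  exists_sub_mem : ∃ e : ι → B, ∀ i, e i - 1 ∈ P i ∧ ∀ j, j ≠ i → e i ∈ P j
  iInf_le_jacobson : ⨅ i, (P i).asIdeal ≤ Ring.jacobson B

/-- Both hypotheses together give `(I K) Y = Y`, and `I K` lies in the intersection because `I` is
two-sided. This drives the induction behind the Nakayama argument for a semilocal family. -/
theorem Ideal.inf_smul_top_eq_top {B Y : Type*} [Ring B] [AddCommGroup Y] [Module B Y]
    {I K : Ideal B} [I.IsTwoSided] (hI : (I • ⊤ : Submodule B Y) = ⊤)
    (hK : (K • ⊤ : Submodule B Y) = ⊤) : ((I ⊓ K) • ⊤ : Submodule B Y) = ⊤ := by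
  rw [eq_top_iff]
  calc (⊤ : Submodule B Y) = I • (K • ⊤ : Submodule B Y) := by rw [hK, hI]
    _ = (I * K) • (⊤ : Submodule B Y) := (Submodule.mul_smul I K ⊤).symm
    _ ≤ (I ⊓ K) • (⊤ : Submodule B Y) := Submodule.smul_mono_left Ideal.mul_le_inf

/-- Reduction modulo an ideal commutes with finite products. -/
theorem nonempty_quotient_smul_top_pi_equiv {B κ : Type*} [Ring B] [Finite κ] (X : κ → Type*)
    [∀ j, AddCommGroup (X j)] [∀ j, Module B (X j)] (I : Ideal B) [I.IsTwoSided] :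
    Nonempty (((∀ j, X j) ⧸ (I • ⊤ : Submodule B (∀ j, X j))) ≃ₗ[B]
      ∀ j, X j ⧸ (I • ⊤ : Submodule B (X j))) := by
  classical
  have := Fintype.ofFinite κ
  let f : (∀ j, X j) →ₗ[B] ∀ j, X j ⧸ (I • ⊤ : Submodule B (X j)) :=
    LinearMap.pi fun j => (Submodule.mkQ _) ∘ₗ LinearMap.proj j
  have hf : Function.Surjective f := fun z => by
    choose y hy using fun j => Submodule.mkQ_surjective _ (z j)
    exact ⟨y, funext hy⟩
  have hker : LinearMap.ker f = I • ⊤ := by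
    apply le_antisymm
    · intro x hx
      have hx' (j) : x j ∈ (I • ⊤ : Submodule B (X j)) :=
        (Submodule.Quotient.mk_eq_zero _).mp (congrFun (LinearMap.mem_ker.mp hx) j)
      rw [← Finset.univ_sum_single x]
      refine Submodule.sum_mem _ fun j _ => ?_
      have := Submodule.mem_map_of_mem (f := LinearMap.single B X j) (hx' j)
      rw [Submodule.map_smul''] at this
      exact Submodule.smul_mono le_rfl le_top this
    · rw [Submodule.smul_le]
      intro b hb x _
      rw [LinearMap.mem_ker]
      funext j
      exact (Submodule.Quotient.mk_eq_zero _).mpr (Submodule.smul_mem_smul hb trivial)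
  exact ⟨(Submodule.quotEquivOfEq _ _ hker.symm) ≪≫ₗ f.quotKerEquivOfSurjective hf⟩

theorem nonempty_quotient_smul_top_equiv {B X Y : Type*} [Ring B] [AddCommGroup X] [Module B X]
    [AddCommGroup Y] [Module B Y] (I : Ideal B) (e : X ≃ₗ[B] Y) :
    Nonempty ((X ⧸ (I • ⊤ : Submodule B X)) ≃ₗ[B] (Y ⧸ (I • ⊤ : Submodule B Y))) :=
  ⟨Submodule.Quotient.equiv _ _ e (by
    change Submodule.map (e : X →ₗ[B] Y) _ = _
    rw [Submodule.map_smul'', Submodule.map_top, LinearEquiv.range])⟩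

/-! ### Lengths modulo an ideal -/

/-- The length of a module modulo an ideal. -/
noncomputable def lengthModulo {B : Type*} [Ring B] (I : Ideal B) (X : Type*) [AddCommGroup X]
    [Module B X] : ℕ∞ := Module.length B (X ⧸ (I • ⊤ : Submodule B X))

theorem lengthModulo_congr {B : Type*} [Ring B] (I : Ideal B) {X Y : Type*}
    [AddCommGroup X] [Module B X] [AddCommGroup Y] [Module B Y] (e : X ≃ₗ[B] Y) :
    lengthModulo I X = lengthModulo I Y :=
  (nonempty_quotient_smul_top_equiv I e).some.length_eq

section lengthModulo

variable {B : Type*} [Ring B] (I : Ideal B) [I.IsTwoSided]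

theorem lengthModulo_pi {κ : Type*} [Fintype κ] (X : κ → Type*)
    [∀ j, AddCommGroup (X j)] [∀ j, Module B (X j)] :
    lengthModulo I (∀ j, X j) = ∑ j, lengthModulo I (X j) := by
  rw [lengthModulo, (nonempty_quotient_smul_top_pi_equiv X I).some.length_eq,
    Module.length_pi_of_fintype]
  rfl

theorem lengthModulo_fun (n : ℕ) (X : Type*) [AddCommGroup X] [Module B X] :
    lengthModulo I (Fin n → X) = n * lengthModulo I X := by
  rw [lengthModulo_pi]; simp

theorem lengthModulo_self : lengthModulo I B = Module.length B (B ⧸ I) := by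
  have : (I • ⊤ : Submodule B B) = I := Ideal.mul_top I
  rw [lengthModulo, this]

theorem exists_linearEquiv_fun_of_isSimpleModule {C : Type*} [Ring C] [IsSimpleRing C]
    [IsArtinianRing C] (S V : Type*) [AddCommGroup S] [Module C S] [IsSimpleModule C S]
    [AddCommGroup V] [Module C V] [Module.Finite C V] :
    ∃ n : ℕ, Nonempty (V ≃ₗ[C] (Fin n → S)) := by
  apply IsIsotypicOfType.linearEquiv_fun
  intro m _
  -- Isotypicity compares simple submodules of one module, so `m` and `S` are both embedded in `m ×
  -- S`.
  let f : m →ₗ[C] m × S := LinearMap.inl C m S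
  let g : S →ₗ[C] m × S := LinearMap.inr C m S
  let ef := LinearEquiv.ofInjective f LinearMap.inl_injective
  let eg := LinearEquiv.ofInjective g LinearMap.inr_injective
  have := IsSimpleModule.congr ef.symm
  have := IsSimpleModule.congr eg.symm
  obtain ⟨e⟩ := IsSimpleRing.isIsotypic C (m × S) (LinearMap.range g) (LinearMap.range f)
  exact ⟨ef ≪≫ₗ e ≪≫ₗ eg.symm⟩

theorem lengthModulo_self_ne_zero [Nontrivial (B ⧸ I)] : lengthModulo I B ≠ 0 := by
  rw [lengthModulo_self, Ne, Module.length_eq_zero_iff, not_subsingleton_iff_nontrivial]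
  infer_instance

/-- The identity of `S` is semilinear along the surjection `B → B/I`, so simplicity over `B/I` and
over `B` coincide. -/
theorem length_eq_one_of_isSimpleModule_quotient (S : Type*) [AddCommGroup S] [Module B S]
    [Module (B ⧸ I) S] [IsScalarTower B (B ⧸ I) S] [IsSimpleModule (B ⧸ I) S] :
    Module.length B S = 1 := by
  let l : S →ₛₗ[Ideal.Quotient.mk I] S :=
    { toFun := id
      map_add' := fun _ _ => rfl
      map_smul' := fun b x => by
        rw [id, id, ← smul_one_smul (B ⧸ I) b x]
        congr 1
        exact (Submodule.Quotient.mk_smul I b 1).symm.trans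
          (congrArg (Ideal.Quotient.mk I) (mul_one b)) }
  have : RingHomSurjective (Ideal.Quotient.mk I) := ⟨Ideal.Quotient.mk_surjective⟩
  rw [Module.length_eq_one_iff]
  exact (LinearMap.isSimpleModule_iff_of_bijective l Function.bijective_id).mpr inferInstance

variable [IsSimpleRing (B ⧸ I)] [IsArtinianRing (B ⧸ I)]

/-- One simple module `S` serves for all `X`, so the length alone determines the reduction modulo
`I`, and comparing lengths is comparing exponents of `S`. -/
theorem exists_quotient_smul_top_equiv_fun (S : Type*) [AddCommGroup S] [Module B S]
    [Module (B ⧸ I) S] [IsScalarTower B (B ⧸ I) S] [IsSimpleModule (B ⧸ I) S]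
    (X : Type*) [AddCommGroup X] [Module B X] [Module.Finite B X] :
    ∃ n : ℕ, Nonempty ((X ⧸ (I • ⊤ : Submodule B X)) ≃ₗ[B] (Fin n → S)) ∧
      lengthModulo I X = n := by
  have : Module.Finite (B ⧸ I) (X ⧸ (I • ⊤ : Submodule B X)) :=
    Module.Finite.of_restrictScalars_finite B _ _
  obtain ⟨n, ⟨e⟩⟩ := exists_linearEquiv_fun_of_isSimpleModule (C := B ⧸ I) S
    (X ⧸ (I • ⊤ : Submodule B X))
  refine ⟨n, ⟨e.restrictScalars B⟩, ?_⟩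
  rw [lengthModulo, (e.restrictScalars B).length_eq, Module.length_pi_of_fintype]
  simp [length_eq_one_of_isSimpleModule_quotient I S]

theorem exists_isSimpleModule_ideal (C : Type*) [Ring C] [Nontrivial C] [IsArtinianRing C] :
    ∃ S : Ideal C, IsSimpleModule C S := by
  obtain ⟨S, hS⟩ := IsAtomic.exists_atom (Ideal C)
  exact ⟨S, isSimpleModule_iff_isAtom.mpr hS⟩

theorem lengthModulo_ne_top (X : Type*) [AddCommGroup X] [Module B X] [Module.Finite B X] :
    lengthModulo I X ≠ ⊤ := by
  obtain ⟨S, _⟩ := exists_isSimpleModule_ideal (B ⧸ I)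
  obtain ⟨n, -, h⟩ := exists_quotient_smul_top_equiv_fun I S X
  simp [h]

theorem exists_surjective_of_lengthModulo_le {X Y : Type*} [AddCommGroup X] [Module B X]
    [Module.Finite B X] [AddCommGroup Y] [Module B Y] [Module.Finite B Y]
    (h : lengthModulo I Y ≤ lengthModulo I X) :
    ∃ f : X →ₗ[B] (Y ⧸ (I • ⊤ : Submodule B Y)), Function.Surjective f := by
  obtain ⟨S, _⟩ := exists_isSimpleModule_ideal (B ⧸ I)
  obtain ⟨m, ⟨e⟩, hm⟩ := exists_quotient_smul_top_equiv_fun I S X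
  obtain ⟨n, ⟨e'⟩, hn⟩ := exists_quotient_smul_top_equiv_fun I S Y
  have hnm : n ≤ m := by rw [hm, hn] at h; exact_mod_cast h
  exact ⟨e'.symm.toLinearMap ∘ₗ LinearMap.funLeft B S (Fin.castLE hnm) ∘ₗ e.toLinearMap ∘ₗ
    Submodule.mkQ _, e'.symm.surjective.comp ((LinearMap.funLeft_surjective_of_injective B S _
      (Fin.castLE_injective hnm)).comp (e.surjective.comp (Submodule.mkQ_surjective _)))⟩

end lengthModulo

/-! ### Surjections over a semilocal ring -/

namespace IsSemilocalFamily

variable {B ι : Type*} [Ring B] {P : ι → TwoSidedIdeal B}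

theorem nonempty [Nontrivial B] (h : IsSemilocalFamily P) : Nonempty ι := by
  by_contra hn
  have := not_nonempty_iff.mp hn
  have hle := h.iInf_le_jacobson
  rw [iInf_of_empty] at hle
  exact (Ring.jacobson_lt_top B).not_ge hle

/-- `Y/N` equals its product with each ideal of the family, hence with their intersection. This lies
in the Jacobson radical, so Nakayama's lemma gives `Y/N = 0`. -/
theorem eq_top_of_forall_sup_eq_top [Finite ι] (h : IsSemilocalFamily P)
    {Y : Type*} [AddCommGroup Y] [Module B Y] [Module.Finite B Y]
    (N : Submodule B Y) (hN : ∀ i, N ⊔ ((P i).asIdeal • ⊤ : Submodule B Y) = ⊤) : N = ⊤ := by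
  have hP (i : ι) : ((P i).asIdeal • ⊤ : Submodule B (Y ⧸ N)) = ⊤ := by
    have := congrArg (Submodule.map N.mkQ) (hN i)
    rwa [Submodule.map_sup, Submodule.map_smul'', Submodule.map_top, Submodule.range_mkQ,
      Submodule.mkQ_map_self, bot_sup_eq] at this
  have := Fintype.ofFinite ι
  have hinf (s : Finset ι) :
      ((⨅ i ∈ s, (P i).asIdeal : Ideal B) • ⊤ : Submodule B (Y ⧸ N)) = ⊤ := by
    classical
    induction s using Finset.induction_on with
    | empty => simp [Submodule.top_smul]
    | insert i s _ ih =>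
      rw [Finset.iInf_insert]
      exact Ideal.inf_smul_top_eq_top (hP i) ih
  have hbot : (⊤ : Submodule B (Y ⧸ N)) = ⊥ := by
    refine Submodule.FG.eq_bot_of_le_jacobson_smul Module.Finite.fg_top ?_
    refine (hinf Finset.univ).ge.trans (Submodule.smul_mono_left ?_)
    simpa using h.iInf_le_jacobson
  rw [← Submodule.Quotient.subsingleton_iff]
  exact (Submodule.subsingleton_iff B).mp (subsingleton_of_bot_eq_top hbot.symm)

/-- Maps from a projective module onto the reductions of a finite module modulo the ideals
of the family come from a surjection. -/
theorem exists_surjective [Finite ι] (h : IsSemilocalFamily P)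
    {X Y : Type*} [AddCommGroup X] [Module B X] [Module.Projective B X]
    [AddCommGroup Y] [Module B Y] [Module.Finite B Y]
    (H : ∀ i, ∃ s : X →ₗ[B] Y ⧸ ((P i).asIdeal • ⊤ : Submodule B Y), Function.Surjective s) :
    ∃ g : X →ₗ[B] Y, Function.Surjective g := by
  have := Fintype.ofFinite ι
  choose s hs using H
  obtain ⟨e, he⟩ := h.exists_sub_mem
  let p : Y →ₗ[B] ∀ i, Y ⧸ ((P i).asIdeal • ⊤ : Submodule B Y) :=
    LinearMap.pi fun i => Submodule.mkQ _
  -- Chinese remainder theorem: `e i` is 1 modulo `P i` and 0 modulo the others, so `∑ i, e i • y i`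
  -- reduces to `y j` modulo `P j`.
  have hp : Function.Surjective p := fun z => by
    choose y hy using fun i => Submodule.mkQ_surjective _ (z i)
    refine ⟨∑ i, e i • y i, funext fun j => ?_⟩
    have hj : ∑ i, e i • y i - y j ∈ ((P j).asIdeal • ⊤ : Submodule B Y) := by
      classical
      rw [← Finset.add_sum_erase _ _ (Finset.mem_univ j), add_sub_right_comm]
      refine Submodule.add_mem _ ?_ (Submodule.sum_mem _ fun i hi => ?_)
      · rw [← one_smul B (y j), smul_smul, mul_one, ← sub_smul]
        exact Submodule.smul_mem_smul (TwoSidedIdeal.mem_asIdeal.mpr (he j).1) trivial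
      · exact Submodule.smul_mem_smul (TwoSidedIdeal.mem_asIdeal.mpr
          ((he i).2 j (Finset.ne_of_mem_erase hi).symm)) trivial
    rw [← hy j]
    exact (Submodule.Quotient.eq _).mpr hj
  -- A lift of all the `s i` at once has image covering `Y` modulo every `P i`, which suffices by
  -- Nakayama.
  obtain ⟨g, hg⟩ := Module.projective_lifting_property p (LinearMap.pi s) hp
  refine ⟨g, LinearMap.range_eq_top.mp (h.eq_top_of_forall_sup_eq_top _ fun i => ?_)⟩
  rw [eq_top_iff]
  intro y _
  obtain ⟨x, hx⟩ := hs i (Submodule.Quotient.mk y)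
  have hgx : Submodule.Quotient.mk (g x) = s i x := congrFun (LinearMap.congr_fun hg x) i
  rw [← sub_add_cancel y (g x), add_comm]
  exact Submodule.add_mem_sup ⟨x, rfl⟩ ((Submodule.Quotient.eq _).mp (hx.symm.trans hgx.symm))

theorem exists_surjective_of_lengthModulo_le [Finite ι] (h : IsSemilocalFamily P)
    {X Y : Type*} [AddCommGroup X] [Module B X]
    [Module.Finite B X] [Module.Projective B X] [AddCommGroup Y] [Module B Y] [Module.Finite B Y]
    (H : ∀ i, lengthModulo (P i).asIdeal Y ≤ lengthModulo (P i).asIdeal X) :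
    ∃ g : X →ₗ[B] Y, Function.Surjective g := by
  refine h.exists_surjective fun i => ?_
  have := h.isSimpleRing i
  have := h.isArtinianRing i
  exact _root_.exists_surjective_of_lengthModulo_le _ (H i)

/-- For a suitable member `I` of the family, some power of `N` is an image of a free module which
has the same rank as the reduction of that power modulo `I`. -/
theorem exists_surjective_fun [Finite ι] (h : IsSemilocalFamily P)
    [Nonempty ι] (N : Type*) [AddCommGroup N] [Module B N]
    [Module.Finite B N] : ∃ (i : ι) (d n : ℕ), 0 < d ∧
      (∃ g : (Fin n → B) →ₗ[B] (Fin d → N), Function.Surjective g) ∧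
      ∃ e : (Fin d → N) →ₗ[B] (Fin n → B ⧸ (P i).asIdeal), Function.Surjective e := by
  have := h.isSimpleRing
  have := h.isArtinianRing
  choose m hm using fun i => ENat.ne_top_iff_exists.mp (lengthModulo_ne_top (P i).asIdeal N)
  choose d hd using fun i => ENat.ne_top_iff_exists.mp (lengthModulo_ne_top (P i).asIdeal B)
  have hd0 (i : ι) : 0 < d i := by
    have := lengthModulo_self_ne_zero (P i).asIdeal
    rw [← hd] at this
    exact Nat.pos_of_ne_zero (by exact_mod_cast this)
  -- At an index maximising `m i / d i`, cross-multiplication shows that `N^(d i)` is no longer than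
  -- `B^(m i)` modulo any `P j`, with equality for `j = i`. The inequalities give `g`, the equality
  -- gives `e`.
  obtain ⟨i, hi⟩ := Finite.exists_max fun i => (m i : ℚ) / d i
  have hi' (j : ι) : d i * m j ≤ m i * d j := by
    have := hi j
    rw [div_le_div_iff₀ (by exact_mod_cast hd0 j) (by exact_mod_cast hd0 i)] at this
    rw [mul_comm (d i)]
    exact_mod_cast this
  refine ⟨i, d i, m i, hd0 i, h.exists_surjective_of_lengthModulo_le fun j => ?_, ?_⟩
  · rw [lengthModulo_fun, lengthModulo_fun, ← hm, ← hd]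
    exact_mod_cast hi' j
  · obtain ⟨f, hf⟩ := _root_.exists_surjective_of_lengthModulo_le (P i).asIdeal
      (X := Fin (d i) → N) (Y := Fin (m i) → B) (by
        rw [lengthModulo_fun, lengthModulo_fun, ← hm, ← hd, mul_comm])
    obtain ⟨e⟩ := nonempty_quotient_smul_top_pi_equiv (fun _ : Fin (m i) => B) (P i).asIdeal
    let e' : (B ⧸ ((P i).asIdeal • ⊤ : Submodule B B)) ≃ₗ[B] B ⧸ (P i).asIdeal :=
      Submodule.quotEquivOfEq _ _ (Ideal.mul_top _)
    exact ⟨(LinearEquiv.piCongrRight fun _ => e').toLinearMap ∘ₗ e.toLinearMap ∘ₗ f,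
      (LinearEquiv.piCongrRight fun _ => e').surjective.comp (e.surjective.comp hf)⟩

/-- The isomorphism `g` makes the ratio of the lengths of `N` and `B` equal to `n / d` modulo every
`P j`. Its value at `i` is `r`, so `N` and `B^r` have equal lengths everywhere. -/
theorem exists_surjective_of_equiv_quotient [Finite ι] (h : IsSemilocalFamily P)
    {N : Type*} [AddCommGroup N] [Module B N]
    [Module.Finite B N] {d n r : ℕ} (hd : 0 < d) (g : (Fin d → N) ≃ₗ[B] (Fin n → B)) (i : ι)
    (e : (N ⧸ ((P i).asIdeal • ⊤ : Submodule B N)) ≃ₗ[B] (Fin r → B ⧸ (P i).asIdeal)) :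
    ∃ f : (Fin r → B) →ₗ[B] N, Function.Surjective f := by
  have := h.isSimpleRing
  have := h.isArtinianRing
  have hg (j : ι) := lengthModulo_congr (P j).asIdeal g
  simp_rw [lengthModulo_fun] at hg
  have he : lengthModulo (P i).asIdeal N = r * lengthModulo (P i).asIdeal B := by
    rw [lengthModulo, e.length_eq, lengthModulo_self, Module.length_pi_of_fintype]
    simp
  have hn : n = d * r := by
    have := hg i
    rw [he] at this
    obtain ⟨b, hb⟩ := ENat.ne_top_iff_exists.mp (lengthModulo_ne_top (P i).asIdeal B)
    have hb0 := lengthModulo_self_ne_zero (P i).asIdeal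
    rw [← hb] at this hb0
    norm_cast at this hb0
    rw [← mul_assoc] at this
    exact (Nat.eq_of_mul_eq_mul_right (Nat.pos_of_ne_zero hb0) this).symm
  refine h.exists_surjective_of_lengthModulo_le fun j => ?_
  have := hg j
  rw [lengthModulo_fun]
  obtain ⟨b, hb⟩ := ENat.ne_top_iff_exists.mp (lengthModulo_ne_top (P j).asIdeal B)
  obtain ⟨c, hc⟩ := ENat.ne_top_iff_exists.mp (lengthModulo_ne_top (P j).asIdeal N)
  rw [← hb, ← hc, hn] at this
  rw [← hb, ← hc]
  norm_cast at this ⊢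
  rw [mul_assoc] at this
  exact (Nat.eq_of_mul_eq_mul_left hd this).le

/-- Since `N` is nonzero, so is `n`; vanishing of `N` modulo `P i` would make `B^n` vanish modulo `P
i`. -/
theorem one_le_lengthModulo (h : IsSemilocalFamily P)
    {N : Type*} [AddCommGroup N] [Module B N] [Nontrivial N]
    {d n : ℕ} (hd : 0 < d) (g : (Fin d → N) ≃ₗ[B] (Fin n → B)) (i : ι) :
    1 ≤ lengthModulo (P i).asIdeal N := by
  have := h.isSimpleRing i
  have hg := lengthModulo_congr (P i).asIdeal g
  simp_rw [lengthModulo_fun] at hg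
  have hn : n ≠ 0 := by
    rintro rfl
    have : Nonempty (Fin d) := ⟨⟨0, hd⟩⟩
    exact not_subsingleton _ g.toEquiv.subsingleton
  rw [Order.one_le_iff_ne_zero]
  intro h0
  rw [h0, mul_zero, eq_comm, mul_eq_zero] at hg
  exact hg.elim (by exact_mod_cast hn) (lengthModulo_self_ne_zero _)

/-- There is a number `D` such that the ring is an image of every product of `D` finite projective
modules which are nonzero modulo every member of the family. -/
theorem exists_surjective_pi [Finite ι] (h : IsSemilocalFamily P) : ∃ D : ℕ, 0 < D ∧
    ∀ (N : Fin D → Type*) [∀ j, AddCommGroup (N j)]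
    [∀ j, Module B (N j)] [∀ j, Module.Finite B (N j)] [∀ j, Module.Projective B (N j)],
    (∀ i j, 1 ≤ lengthModulo (P i).asIdeal (N j)) →
    ∃ f : (∀ j, N j) →ₗ[B] B, Function.Surjective f := by
  have := h.isSimpleRing
  have := h.isArtinianRing
  have := Fintype.ofFinite ι
  choose d hd using fun i => ENat.ne_top_iff_exists.mp (lengthModulo_ne_top (P i).asIdeal B)
  -- Each factor contributes length at least 1, so it is enough that `D` bounds every `d i`; the
  -- extra 1 keeps `D` positive.
  refine ⟨∑ i, d i + 1, Nat.succ_pos _, fun N _ _ _ _ hN => ?_⟩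
  have : Module.Projective B (∀ j, N j) := .of_equiv' (DFinsupp.linearEquivFunOnFintype (R := B))
  refine h.exists_surjective_of_lengthModulo_le fun i => ?_
  rw [lengthModulo_pi, ← hd]
  calc (d i : ℕ∞) ≤ ((∑ i, d i + 1 : ℕ) : ℕ∞) := by
        exact_mod_cast (Finset.single_le_sum (fun _ _ => Nat.zero_le _)
          (Finset.mem_univ i)).trans (Nat.le_succ _)
    _ = ∑ j : Fin (∑ i, d i + 1), (1 : ℕ∞) := by simp
    _ ≤ _ := Finset.sum_le_sum fun j _ => hN i j

end IsSemilocalFamily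

/-! ### Maximal ideals of a semilocal ring and passage to the opposite ring -/

/-- Left-right symmetry of the radical. A left inverse `z` of `1 + x y` equals `1 - z x y`, so it
has a left inverse itself; thus `z` is also a right inverse, as the opposite ring requires. -/
theorem MulOpposite.op_mem_jacobson {A : Type*} [Ring A] {x : A} (hx : x ∈ Ring.jacobson A) :
    MulOpposite.op x ∈ Ring.jacobson Aᵐᵒᵖ := by
  have inv (r : A) (hr : r ∈ Ring.jacobson A) : ∃ z, z * (1 + r) = 1 := by
    rw [← Ideal.jacobson_bot, Ideal.mem_jacobson_iff] at hr
    obtain ⟨z, hz⟩ := hr 1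
    exact ⟨z, by rw [Ideal.mem_bot, sub_eq_zero, mul_one] at hz; rw [mul_add, mul_one, add_comm, hz]⟩
  rw [← Ideal.jacobson_bot, Ideal.mem_jacobson_iff]
  intro y
  have hxy : x * y.unop ∈ Ring.jacobson A := Ideal.mul_mem_right _ _ hx
  obtain ⟨z, hz⟩ := inv _ hxy
  obtain ⟨w, hw⟩ := inv (-(z * (x * y.unop))) (neg_mem (Ideal.mul_mem_left _ _ hxy))
  have hz' : 1 + -(z * (x * y.unop)) = z := by
    rw [← sub_eq_add_neg, sub_eq_iff_eq_add]
    rw [mul_add, mul_one] at hz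
    exact hz.symm
  rw [hz'] at hw
  have hw' : w = 1 + x * y.unop := by
    calc w = w * (z * (1 + x * y.unop)) := by rw [hz, mul_one]
      _ = 1 + x * y.unop := by rw [← mul_assoc, hw, one_mul]
  refine ⟨MulOpposite.op z, ?_⟩
  rw [Ideal.mem_bot, sub_eq_zero]
  apply MulOpposite.unop_injective
  simp only [MulOpposite.unop_add, MulOpposite.unop_mul, MulOpposite.unop_op, MulOpposite.unop_one]
  rw [← hw, hw']
  noncomm_ring

namespace TwoSidedIdeal

variable {A : Type*} [Ring A]

/-- The largest two-sided ideal whose elements `a` satisfy `a b x ∈ I` for all `b`. -/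
def residual (I : Ideal A) (x : A) : TwoSidedIdeal A :=
  .mk' {a | ∀ b, a * b * x ∈ I}
    (fun b => by simp)
    (fun ha ha' b => by simpa [add_mul] using I.add_mem (ha b) (ha' b))
    (fun ha b => by simpa using ha b)
    (fun {c a} ha b => by rw [mul_assoc, mul_assoc, ← mul_assoc a]; exact I.mul_mem_left c (ha b))
    (fun {a c} ha b => by rw [mul_assoc a]; exact ha (c * b))

theorem mem_residual {I : Ideal A} {x a : A} : a ∈ residual I x ↔ ∀ b, a * b * x ∈ I :=
  mem_mk' _ _ _ _ _ _ _

theorem residual_ne_top {I : Ideal A} {x : A} (hx : x ∉ I) : residual I x ≠ ⊤ := fun h =>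
  hx (by simpa using mem_residual.mp (h ▸ mem_top _ : (1 : A) ∈ residual I x) 1)

/-- Let `m` be a maximal left ideal containing `Q`. The two-sided ideal `residual m 1` is proper and
contains `Q`, hence equals it; and it contains the radical, which is two-sided and lies in `m`. -/
theorem jacobson_le_of_isCoatom {Q : TwoSidedIdeal A} (hQ : IsCoatom Q) :
    Ring.jacobson A ≤ Q.asIdeal := by
  have hne : Q.asIdeal ≠ ⊤ := fun h => hQ.1 (eq_top_iff.mpr fun x _ =>
    mem_asIdeal.mp (h ▸ Submodule.mem_top))
  obtain ⟨m, hm, hle⟩ := Ideal.exists_le_maximal _ hne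
  have hQm : Q = residual m 1 := ((hQ.le_iff_eq
    (residual_ne_top ((Ideal.ne_top_iff_one _).mp hm.ne_top))).mp fun a ha =>
      mem_residual.mpr fun b => by
        rw [mul_one]; exact hle (mem_asIdeal.mpr (Q.mul_mem_right _ _ ha))).symm
  intro a ha
  rw [mem_asIdeal, hQm, mem_residual]
  intro b
  rw [mul_one]
  exact Ring.jacobson_le_of_isMaximal m (Ideal.mul_mem_right _ _ ha)

theorem isCoatom_ker {E : Type*} [Ring E] [IsSimpleRing E] (f : A →+* E)
    (hf : Function.Surjective f) : IsCoatom (ker f) := by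
  refine ⟨fun h => one_ne_zero (α := E) ?_, fun Q hQ => ?_⟩
  · rw [← map_one f, ← mem_ker, h]; exact mem_top _
  · let K : TwoSidedIdeal E := .mk' (f '' Q) ⟨0, Q.zero_mem, map_zero f⟩
      (by rintro _ _ ⟨a, ha, rfl⟩ ⟨b, hb, rfl⟩; exact ⟨a + b, Q.add_mem ha hb, map_add _ _ _⟩)
      (by rintro _ ⟨a, ha, rfl⟩; exact ⟨-a, Q.neg_mem ha, map_neg _ _⟩)
      (by
        rintro c _ ⟨a, ha, rfl⟩
        obtain ⟨c, rfl⟩ := hf c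
        exact ⟨c * a, Q.mul_mem_left _ _ ha, map_mul _ _ _⟩)
      (by
        rintro _ c ⟨a, ha, rfl⟩
        obtain ⟨c, rfl⟩ := hf c
        exact ⟨a * c, Q.mul_mem_right _ _ ha, map_mul _ _ _⟩)
    have hK {y : E} : y ∈ K ↔ ∃ a ∈ Q, f a = y := mem_mk' _ _ _ _ _ _ _
    obtain ⟨x, hxQ, hx⟩ := SetLike.exists_of_lt hQ
    obtain ⟨a, ha, ha1⟩ := hK.mp (IsSimpleRing.one_mem_of_ne_zero_mem K
      (fun h => hx ((mem_ker f).mpr h)) (hK.mpr ⟨x, hxQ, rfl⟩))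
    have h1 : (1 : A) - a ∈ Q := hQ.le ((mem_ker f).mpr (by rw [map_sub, map_one, ha1, sub_self]))
    have h1 : (1 : A) ∈ Q := by simpa using Q.add_mem h1 ha
    exact eq_top_iff.mpr fun y _ => by simpa using Q.mul_mem_left y 1 h1

end TwoSidedIdeal

theorem isSimpleRing_quotient_of_eq_ker {B E : Type*} [Ring B] [Ring E] [IsSimpleRing E]
    (f : B →+* E) (hf : Function.Surjective f) (I : Ideal B) [I.IsTwoSided]
    (hI : I = RingHom.ker f) : IsSimpleRing (B ⧸ I) := by
  subst hI
  exact IsSimpleRing.of_ringEquiv (RingHom.quotientKerEquivOfSurjective hf).symm inferInstance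

theorem isArtinianRing_quotient_of_eq_ker {B E : Type*} [Ring B] [Ring E] [IsArtinianRing E]
    (f : B →+* E) (hf : Function.Surjective f) (I : Ideal B) [I.IsTwoSided]
    (hI : I = RingHom.ker f) : IsArtinianRing (B ⧸ I) := by
  subst hI
  exact (RingHom.quotientKerEquivOfSurjective hf).symm.surjective.isArtinianRing
    (f := (RingHom.quotientKerEquivOfSurjective hf).symm.toRingHom)

/-- By Wedderburn–Artin the quotient by the radical is a finite product of matrix rings over
division rings; the kernels of the projections from `A` to the factors are all the maximal ideals.
-/
theorem IsSemilocal.exists_isSemilocalFamily {A : Type*} [Ring A] (hA : IsSemilocal A) :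
    ∃ (n : ℕ) (Q : Fin n → TwoSidedIdeal A), IsSemilocalFamily (fun i => (Q i).op) ∧
      ∀ Q', IsCoatom Q' ↔ ∃ i, Q i = Q' := by
  have : IsSemisimpleRing (A ⧸ Ring.jacobson A) := hA
  obtain ⟨n, D, d, _, _, ⟨ε⟩⟩ :=
    IsSemisimpleRing.exists_ringEquiv_pi_matrix_divisionRing (A ⧸ Ring.jacobson A)
  let p (i : Fin n) : A →+* Matrix (Fin (d i)) (Fin (d i)) (D i) :=
    (Pi.evalRingHom _ i).comp (ε.toRingHom.comp (Ideal.Quotient.mk _))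
  have hp (y : ∀ i, Matrix (Fin (d i)) (Fin (d i)) (D i)) : ∃ x, ∀ i, p i x = y i := by
    obtain ⟨x, hx⟩ := Ideal.Quotient.mk_surjective (ε.symm y)
    exact ⟨x, fun i => by simp [p, hx]⟩
  have hsurj (i : Fin n) : Function.Surjective (p i) := fun y => by
    classical
    obtain ⟨x, hx⟩ := hp (Pi.single i y)
    exact ⟨x, by rw [hx, Pi.single_eq_same]⟩
  have hker (x : A) (hx : ∀ i, p i x = 0) : x ∈ Ring.jacobson A := by
    rw [← Ideal.Quotient.eq_zero_iff_mem]
    exact ε.injective (by rw [map_zero]; exact funext hx)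
  have hex : ∃ e : Fin n → A, ∀ i, p i (e i) = 1 ∧ ∀ j, j ≠ i → p j (e i) = 0 := by
    classical
    choose e he using fun i => hp (Pi.single i 1)
    exact ⟨e, fun i => ⟨by rw [he, Pi.single_eq_same], fun j hj => by
      rw [he, Pi.single_eq_of_ne hj]⟩⟩
  obtain ⟨e, he⟩ := hex
  have hcoatom (i : Fin n) : IsCoatom (TwoSidedIdeal.ker (p i)) :=
    TwoSidedIdeal.isCoatom_ker _ (hsurj i)
  have hop (i : Fin n) : (TwoSidedIdeal.ker (p i)).op.asIdeal = RingHom.ker (p i).op := by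
    ext x
    rw [TwoSidedIdeal.mem_asIdeal, TwoSidedIdeal.mem_op_iff, TwoSidedIdeal.mem_ker,
      RingHom.mem_ker]
    exact MulOpposite.op_eq_zero_iff _ |>.symm
  have hopsurj (i : Fin n) : Function.Surjective (p i).op := fun y => by
    obtain ⟨x, hx⟩ := hsurj i y.unop
    exact ⟨MulOpposite.op x, MulOpposite.unop_injective hx⟩
  refine ⟨n, fun i => TwoSidedIdeal.ker (p i), ⟨fun i => ?_, fun i => ?_, ?_, ?_⟩, fun Q' =>
    ⟨fun hQ' => ?_, ?_⟩⟩
  · exact isSimpleRing_quotient_of_eq_ker _ (hopsurj i) _ (hop i)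
  · exact isArtinianRing_quotient_of_eq_ker _ (hopsurj i) _ (hop i)
  · refine ⟨fun i => MulOpposite.op (e i), fun i => ⟨?_, fun j hj => ?_⟩⟩
    · rw [TwoSidedIdeal.mem_op_iff, TwoSidedIdeal.mem_ker]
      simp [(he i).1]
    · rw [TwoSidedIdeal.mem_op_iff, TwoSidedIdeal.mem_ker]
      exact (he i).2 j hj
  · intro x hx
    rw [← MulOpposite.op_unop x]
    refine MulOpposite.op_mem_jacobson (hker _ fun i => ?_)
    rw [Ideal.mem_iInf] at hx
    rw [← TwoSidedIdeal.mem_ker, ← TwoSidedIdeal.mem_op_iff]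
    exact TwoSidedIdeal.mem_asIdeal.mp (hx i)
  · have hJ := TwoSidedIdeal.jacobson_le_of_isCoatom hQ'
    obtain ⟨i, hi⟩ : ∃ i, e i ∉ Q' := by
      by_contra! hall
      have h1 : (1 : A) - ∑ i, e i ∈ Q' := TwoSidedIdeal.mem_asIdeal.mp (hJ (hker _ fun j => by
        rw [map_sub, map_one, map_sum, Finset.sum_eq_single j (fun i _ hij => (he i).2 j hij.symm)
          (by simp), (he j).1, sub_self]))
      have h2 : ∑ i, e i ∈ Q' := TwoSidedIdeal.mem_asIdeal.mp
        (sum_mem fun i _ => TwoSidedIdeal.mem_asIdeal.mpr (hall i))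
      have h3 : (1 : A) ∈ Q' := by simpa using Q'.add_mem h1 h2
      exact hQ'.1 (eq_top_iff.mpr fun y _ => by simpa using Q'.mul_mem_left y 1 h3)
    -- The proper ideal of all `a` with `a b (e i) ∈ Q'` for every `b` contains both `Q'` and the
    -- kernel of `p i`, so by maximality all three coincide.
    have hne := TwoSidedIdeal.residual_ne_top (I := Q'.asIdeal) (x := e i)
      (fun h => hi (TwoSidedIdeal.mem_asIdeal.mp h))
    refine ⟨i, (((hcoatom i).le_iff_eq hne).mp fun a ha => ?_).symm.trans
      ((hQ'.le_iff_eq hne).mp fun a ha => ?_)⟩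
    · refine TwoSidedIdeal.mem_residual.mpr fun b => hJ (hker _ fun j => ?_)
      rw [map_mul, map_mul]
      by_cases hj : j = i
      · subst hj; rw [(TwoSidedIdeal.mem_ker _).mp ha, zero_mul, zero_mul]
      · rw [(he i).2 j hj, mul_zero]
    · exact TwoSidedIdeal.mem_residual.mpr fun b => TwoSidedIdeal.mem_asIdeal.mpr
        (Q'.mul_mem_right _ _ (Q'.mul_mem_right _ _ ha))
  · rintro ⟨i, rfl⟩; exact hcoatom i

/-! ### Transport of comodule structures -/

section Naturality

variable {k C V W : Type*} [CommSemiring k] [AddCommMonoid C] [Module k C] [AddCommMonoid V]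
  [Module k V] [AddCommMonoid W] [Module k W]

theorem rTensor_assoc_rTensor_of_rTensor_comp {f : V →ₗ[k] W} {ρ : V →ₗ[k] V ⊗[k] C}
    {σ : W →ₗ[k] W ⊗[k] C} (hf : ∀ v, f.rTensor C (ρ v) = σ (f v)) (v : V) :
    f.rTensor (C ⊗[k] C) (TensorProduct.assoc k V C C (ρ.rTensor C (ρ v))) =
      TensorProduct.assoc k W C C (σ.rTensor C (σ (f v))) := by
  have h1 : f.rTensor (C ⊗[k] C) ∘ₗ (TensorProduct.assoc k V C C).toLinearMap =
      (TensorProduct.assoc k W C C).toLinearMap ∘ₗ (f.rTensor C).rTensor C := by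
    ext; simp
  have h2 : (f.rTensor C).rTensor C ∘ₗ ρ.rTensor C = σ.rTensor C ∘ₗ f.rTensor C := by
    rw [← LinearMap.rTensor_comp, ← LinearMap.rTensor_comp,
      LinearMap.ext hf (f := _ ∘ₗ _) (g := _ ∘ₗ _)]
  refine (LinearMap.congr_fun h1 _).trans (congrArg (TensorProduct.assoc k W C C) ?_)
  exact (LinearMap.congr_fun h2 _).trans (congrArg (σ.rTensor C) (hf v))

end Naturality

/-- The coaction of a comodule, with explicit arguments. -/
abbrev coaction (k C V : Type*) [CommSemiring k] [AddCommMonoid C] [Module k C]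
    [Coalgebra k C] [AddCommMonoid V] [Module k V] [RightComodule k C V] : V →ₗ[k] V ⊗[k] C :=
  RightComodule.coact

theorem assoc_rTensor_coaction {k C V : Type*} [CommSemiring k] [AddCommMonoid C] [Module k C]
    [Coalgebra k C] [AddCommMonoid V] [Module k V] [RightComodule k C V] (v : V) :
    TensorProduct.assoc k V C C ((coaction k C V).rTensor C (coaction k C V v)) =
      (Coalgebra.comul (R := k) (A := C)).lTensor V (coaction k C V v) :=
  LinearMap.congr_fun RightComodule.coassoc v

theorem rid_lTensor_counit_coaction {k C V : Type*} [CommSemiring k] [AddCommMonoid C] [Module k C]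
    [Coalgebra k C] [AddCommMonoid V] [Module k V] [RightComodule k C V] (v : V) :
    TensorProduct.rid k V ((Coalgebra.counit (R := k) (A := C)).lTensor V (coaction k C V v)) = v :=
  LinearMap.congr_fun RightComodule.counit_coact v

section Transfer

variable {k C V W : Type*} [CommSemiring k] [AddCommMonoid C] [Module k C] [Coalgebra k C]
  [AddCommMonoid V] [Module k V] [AddCommMonoid W] [Module k W]

/-- A comodule structure on the image of a comodule. -/
@[reducible] def RightComodule.ofSurjective [RightComodule k C V] (f : V →ₗ[k] W)
    (hf : Function.Surjective f) (σ : W →ₗ[k] W ⊗[k] C)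
    (h : ∀ v, f.rTensor C (coaction k C V v) = σ (f v)) : RightComodule k C W where
  coact := σ
  coassoc := by
    ext w
    obtain ⟨v, rfl⟩ := hf w
    refine (rTensor_assoc_rTensor_of_rTensor_comp h v).symm.trans ?_
    rw [assoc_rTensor_coaction]
    change (f.rTensor (C ⊗[k] C) ∘ₗ Coalgebra.comul.lTensor V) (coaction k C V v) =
      Coalgebra.comul.lTensor W (σ (f v))
    rw [LinearMap.rTensor_comp_lTensor, ← LinearMap.lTensor_comp_rTensor, LinearMap.comp_apply, h]
  counit_coact := by
    ext w
    obtain ⟨v, rfl⟩ := hf w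
    have h1 : (TensorProduct.rid k W).toLinearMap ∘ₗ (Coalgebra.counit (R := k) (A := C)).lTensor W
        ∘ₗ f.rTensor C = f ∘ₗ (TensorProduct.rid k V).toLinearMap ∘ₗ
        (Coalgebra.counit (R := k) (A := C)).lTensor V := by ext; simp
    change TensorProduct.rid k W (Coalgebra.counit.lTensor W (σ (f v))) = f v
    rw [← h]
    exact (LinearMap.congr_fun h1 _).trans (congrArg f (rid_lTensor_counit_coaction v))

/-- A comodule structure on a subspace of a comodule. -/
@[reducible] def RightComodule.ofInjective [RightComodule k C W] (f : V →ₗ[k] W)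
    (hf : Function.Injective f) (hf' : Function.Injective (f.rTensor (C ⊗[k] C)))
    (ρ : V →ₗ[k] V ⊗[k] C)
    (h : ∀ v, f.rTensor C (ρ v) = coaction k C W (f v)) : RightComodule k C V where
  coact := ρ
  coassoc := by
    ext v
    apply hf'
    refine (rTensor_assoc_rTensor_of_rTensor_comp h v).trans ?_
    rw [assoc_rTensor_coaction]
    change Coalgebra.comul.lTensor W (coaction k C W (f v)) =
      (f.rTensor (C ⊗[k] C) ∘ₗ Coalgebra.comul.lTensor V) (ρ v)
    rw [LinearMap.rTensor_comp_lTensor, ← LinearMap.lTensor_comp_rTensor, LinearMap.comp_apply, h]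
  counit_coact := by
    ext v
    apply hf
    have h1 : (TensorProduct.rid k W).toLinearMap ∘ₗ (Coalgebra.counit (R := k) (A := C)).lTensor W
        ∘ₗ f.rTensor C = f ∘ₗ (TensorProduct.rid k V).toLinearMap ∘ₗ
        (Coalgebra.counit (R := k) (A := C)).lTensor V := by ext; simp
    refine (LinearMap.congr_fun h1 _).symm.trans ?_
    change TensorProduct.rid k W (Coalgebra.counit.lTensor W (f.rTensor C (ρ v))) = f v
    rw [h]
    exact rid_lTensor_counit_coaction _

end Transfer

/-! ### Hopf submodules, quotients and local finiteness -/

section HopfModule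

variable (k H : Type*) {A M N : Type*} [Field k] [Ring H] [HopfAlgebra k H] [Ring A]
  [Algebra k A]
  [AddCommGroup M] [Module k M] [Module Aᵐᵒᵖ M] [IsScalarTower k Aᵐᵒᵖ M]
  [AddCommGroup N] [Module k N] [Module Aᵐᵒᵖ N] [IsScalarTower k Aᵐᵒᵖ N]

theorem rTensor_tensorRightAct (f : M →ₗ[Aᵐᵒᵖ] N) (t : M ⊗[k] H) (s : A ⊗[k] H) :
    (f.restrictScalars k).rTensor H (tensorRightAct k H A M t s) =
      tensorRightAct k H A N ((f.restrictScalars k).rTensor H t) s := by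
  induction t with
  | zero => simp
  | add x y hx hy => simp only [map_add, LinearMap.add_apply, hx, hy]
  | tmul m g =>
    induction s with
    | zero => simp
    | add x y hx hy => simp only [map_add, hx, hy]
    | tmul a h => simp [tensorRightAct]

variable {k H} in
theorem range_rTensor_subtype_mono {L L' : Submodule Aᵐᵒᵖ M} (h : L ≤ L') :
    LinearMap.range ((L.subtype.restrictScalars k).rTensor H) ≤
      LinearMap.range ((L'.subtype.restrictScalars k).rTensor H) := by
  have : L.subtype.restrictScalars k =
    (L'.subtype.restrictScalars k) ∘ₗ (Submodule.inclusion h).restrictScalars k := rfl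
  rw [this, LinearMap.rTensor_comp]
  exact LinearMap.range_comp_le_range _ _

variable [ComoduleAlgebra k H A]

variable {k H} in
theorem coaction_op_smul [RightHopfModule k H A M] (m : M) (a : A) :
    coaction k H M (MulOpposite.op a • m) =
      tensorRightAct k H A M (coaction k H M m) (coaction k H A a) :=
  RightHopfModule.coact_act m a

/-- A submodule `L` of a Hopf module `M` with `ρ(L) ⊆ L ⊗ H`. -/
def IsHopfSubmodule [RightHopfModule k H A M] (L : Submodule Aᵐᵒᵖ M) : Prop :=
  ∀ y ∈ L, coaction k H M y ∈ LinearMap.range ((L.subtype.restrictScalars k).rTensor H)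

variable {k H}

/-- `H` is flat over the field `k`, so the kernel of `g ⊗ H` is the image of `ker g ⊗ H`. No
coaction on `N` is needed. -/
theorem isHopfSubmodule_ker_iff [RightHopfModule k H A M] (g : M →ₗ[Aᵐᵒᵖ] N) :
    IsHopfSubmodule k H (LinearMap.ker g) ↔
      ∀ y ∈ LinearMap.ker g, (g.restrictScalars k).rTensor H (coaction k H M y) = 0 := by
  have hex : Function.Exact ((LinearMap.ker g).subtype.restrictScalars k) (g.restrictScalars k) :=
    LinearMap.exact_subtype_ker_map g
  have := Module.Flat.rTensor_exact H hex
  exact forall₂_congr fun y _ => (this _).symm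

theorem IsHopfSubmodule.span [RightHopfModule k H A M] (s : Set M)
    (hs : ∀ y ∈ s, coaction k H M y ∈
      LinearMap.range (((Submodule.span Aᵐᵒᵖ s).subtype.restrictScalars k).rTensor H)) :
    IsHopfSubmodule k H (Submodule.span Aᵐᵒᵖ s) := by
  intro y hy
  induction hy using Submodule.span_induction with
  | mem x hx => exact hs x hx
  | zero => simp
  | add x y _ _ hx hy => rw [map_add]; exact add_mem hx hy
  | smul a x _ hx =>
    obtain ⟨t, ht⟩ := hx
    rw [← MulOpposite.op_unop a, coaction_op_smul, ← ht, ← rTensor_tensorRightAct]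
    exact ⟨_, rfl⟩

theorem IsHopfSubmodule.sSup [RightHopfModule k H A M] (c : Set (Submodule Aᵐᵒᵖ M))
    (hc : ∀ L ∈ c, IsHopfSubmodule k H L) : IsHopfSubmodule k H (sSup c) := by
  intro y hy
  rw [sSup_eq_iSup'] at hy
  refine Submodule.iSup_induction _ (motive := fun y => coaction k H M y ∈ LinearMap.range _) hy
    (fun L x hx => range_rTensor_subtype_mono (le_sSup L.2) (hc L L.2 x hx)) ?_ fun x y hx hy => ?_
  · rw [map_zero]; exact zero_mem _
  · rw [map_add]; exact add_mem hx hy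

/-- The Hopf module structure on a Hopf submodule. -/
@[reducible] noncomputable def IsHopfSubmodule.rightHopfModule [RightHopfModule k H A M]
    {L : Submodule Aᵐᵒᵖ M} (hL : IsHopfSubmodule k H L) : RightHopfModule k H A L :=
  let f := L.subtype.restrictScalars k
  have hf : Function.Injective f := Subtype.val_injective
  have hf' := Module.Flat.rTensor_preserves_injective_linearMap (M := H) f hf
  let ρ : L →ₗ[k] L ⊗[k] H := (LinearEquiv.ofInjective _ hf').symm.toLinearMap ∘ₗ
    (coaction k H M ∘ₗ f).codRestrict _ fun y => hL y y.2
  have hρ (y : L) : f.rTensor H (ρ y) = coaction k H M (f y) :=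
    congrArg Subtype.val ((LinearEquiv.ofInjective _ hf').apply_symm_apply ⟨_, hL y y.2⟩)
  { toRightComodule := RightComodule.ofInjective f hf
      (Module.Flat.rTensor_preserves_injective_linearMap f hf) ρ hρ
    coact_act := fun m a => by
      apply hf'
      change f.rTensor H (ρ _) = f.rTensor H (tensorRightAct k H A L (ρ m) _)
      rw [hρ, rTensor_tensorRightAct, hρ]
      exact coaction_op_smul _ _ }

/-- The Hopf module structure on the quotient by a Hopf submodule. -/
@[reducible] noncomputable def IsHopfSubmodule.rightHopfModuleQuotient [RightHopfModule k H A M]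
    {L : Submodule Aᵐᵒᵖ M} (hL : IsHopfSubmodule k H L) : RightHopfModule k H A (M ⧸ L) :=
  let f := L.mkQ.restrictScalars k
  have hf : Function.Surjective f := L.mkQ_surjective
  let σ : (M ⧸ L) →ₗ[k] (M ⧸ L) ⊗[k] H :=
    (L.restrictScalars k).liftQ (f.rTensor H ∘ₗ coaction k H M) (fun y hy => by
      have h := (isHopfSubmodule_ker_iff (k := k) (H := H) L.mkQ).mp (by rwa [L.ker_mkQ])
      exact h y (by rwa [L.ker_mkQ])) ∘ₗ
    (Submodule.Quotient.restrictScalarsEquiv k L).symm.toLinearMap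
  have hσ (y : M) : f.rTensor H (coaction k H M y) = σ (f y) := rfl
  { toRightComodule := RightComodule.ofSurjective f hf σ hσ
    coact_act := fun m a => by
      obtain ⟨m, rfl⟩ := hf m
      change σ (MulOpposite.op a • L.mkQ m) = tensorRightAct k H A (M ⧸ L) (σ (f m)) _
      rw [← hσ, ← rTensor_tensorRightAct, ← map_smul]
      change σ (f _) = _
      rw [← hσ, coaction_op_smul] }

/-- The preimage is the kernel of `M → M/L → (M/L)/K`, so the kernel criterion reduces the claim to
the one for `K`. -/
theorem IsHopfSubmodule.comap_mkQ [RightHopfModule k H A M]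
    {L : Submodule Aᵐᵒᵖ M} (hL : IsHopfSubmodule k H L) (K : Submodule Aᵐᵒᵖ (M ⧸ L))
    (hK : letI := hL.rightHopfModuleQuotient; IsHopfSubmodule k H K) :
    IsHopfSubmodule k H (K.comap L.mkQ) := by
  let := hL.rightHopfModuleQuotient
  have hker : LinearMap.ker (K.mkQ ∘ₗ L.mkQ) = K.comap L.mkQ := by
    rw [LinearMap.ker_comp, K.ker_mkQ]
  rw [← hker, isHopfSubmodule_ker_iff]
  intro y hy
  have h := (isHopfSubmodule_ker_iff (k := k) (H := H) K.mkQ).mp (by rwa [K.ker_mkQ])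
  have := h (L.mkQ y) (LinearMap.mem_ker.mpr (LinearMap.mem_ker.mp hy))
  rw [← this]
  change ((K.mkQ.restrictScalars k) ∘ₗ (L.mkQ.restrictScalars k)).rTensor H _ = _
  rw [LinearMap.rTensor_comp]
  rfl

/-- Hopf modules are locally finite. -/
theorem exists_isHopfSubmodule_mem [RightHopfModule k H A M] (x : M) :
    ∃ L : Submodule Aᵐᵒᵖ M, L.FG ∧ IsHopfSubmodule k H L ∧ x ∈ L := by
  classical
  -- `L` is generated by the finitely many nonzero coefficients `f i` in the expansion `ρ(x) = ∑ f i
  -- ⊗ b i`.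
  let b := Module.Basis.ofVectorSpace k H
  let f := TensorProduct.equivFinsuppOfBasisRight (M := M) b (coaction k H M x)
  have hf : coaction k H M x = f.sum fun i m => m ⊗ₜ[k] b i := by
    rw [← TensorProduct.equivFinsuppOfBasisRight_symm_apply, LinearEquiv.symm_apply_apply]
  let L := Submodule.span Aᵐᵒᵖ (Set.range f)
  have hfL (i) : f i ∈ L := Submodule.subset_span ⟨i, rfl⟩
  refine ⟨L, ⟨insert 0 (f.support.image f), ?_⟩, IsHopfSubmodule.span _ ?_, ?_⟩
  · rw [Finset.coe_insert, Submodule.span_insert_zero, Finset.coe_image]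
    apply le_antisymm (Submodule.span_mono (Set.image_subset_range _ _))
    rw [Submodule.span_le]
    rintro _ ⟨i, rfl⟩
    by_cases hi : f i = 0
    · rw [hi]; exact zero_mem _
    · exact Submodule.subset_span ⟨i, Finsupp.mem_support_iff.mpr hi, rfl⟩
  · rintro _ ⟨j, rfl⟩
    -- `f j` is obtained from `ρ(x)` by the coordinate functional of `b j`. Hence `ρ(f j)` comes
    -- from `(ρ ⊗ id) ρ(x)`, which by coassociativity is `∑ f i ⊗ Δ(b i)`, with all left factors in
    -- `L`.
    have h1 : coaction k H M ∘ₗ (TensorProduct.rid k M).toLinearMap ∘ₗ (b.coord j).lTensor M =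
        (TensorProduct.rid k (M ⊗[k] H)).toLinearMap ∘ₗ (b.coord j).lTensor (M ⊗[k] H) ∘ₗ
          (coaction k H M).rTensor H := by
      ext; simp
    rw [TensorProduct.equivFinsuppOfBasisRight_apply]
    refine (congrArg (· ∈ LinearMap.range _) (LinearMap.congr_fun h1 (coaction k H M x))).mpr ?_
    have h2 := (TensorProduct.assoc k M H H).symm_apply_apply
      ((coaction k H M).rTensor H (coaction k H M x))
    rw [assoc_rTensor_coaction] at h2
    simp only [LinearMap.comp_apply]
    rw [← h2, hf, Finsupp.sum, map_sum, map_sum, map_sum, map_sum]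
    refine sum_mem fun i _ => ?_
    rw [LinearMap.lTensor_tmul]
    generalize Coalgebra.comul (R := k) (b i) = w
    induction w with
    | zero => simp
    | add u v hu hv => simp only [TensorProduct.tmul_add, map_add]; exact add_mem hu hv
    | tmul g h =>
      refine ⟨(⟨f i, hfL i⟩ : L) ⊗ₜ[k] (b.coord j h • g), ?_⟩
      simp
  -- The counit gives `x = ∑ ε(b i) f i`.
  · rw [← rid_lTensor_counit_coaction (k := k) (C := H) x, hf, Finsupp.sum, map_sum, map_sum]
    refine sum_mem fun i _ => ?_
    rw [LinearMap.lTensor_tmul, TensorProduct.rid_tmul]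
    exact L.smul_of_tower_mem _ (hfL i)

end HopfModule

/-! ### The reduced coaction `A → A/Q ⊗ H` -/

section Tensor

variable {k C D V W : Type*} [CommSemiring k] [AddCommMonoid C] [Module k C] [AddCommMonoid D]
  [Module k D] [AddCommMonoid V] [Module k V] [AddCommMonoid W] [Module k W]

theorem rTensor_map_comp_assoc_symm_comp_lTensor (δ : C →ₗ[k] C ⊗[k] C) (f : V →ₗ[k] W)
    (e : C ≃ₗ[k] D) :
    (TensorProduct.map f e.toLinearMap).rTensor C ∘ₗ
        (TensorProduct.assoc k V C C).symm.toLinearMap ∘ₗ δ.lTensor V =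
      ((e.toLinearMap.lTensor W).rTensor C ∘ₗ (TensorProduct.assoc k W C C).symm.toLinearMap ∘ₗ
        (δ ∘ₗ e.symm.toLinearMap).lTensor W) ∘ₗ TensorProduct.map f e.toLinearMap := by
  ext x h
  simp only [TensorProduct.AlgebraTensorModule.curry_apply, TensorProduct.curry_apply,
    LinearMap.coe_restrictScalars, LinearMap.comp_apply, LinearMap.lTensor_tmul,
    TensorProduct.map_tmul, LinearEquiv.coe_coe, LinearEquiv.symm_apply_apply]
  generalize δ h = w
  induction w with
  | zero => simp
  | add u v hu hv => simp only [TensorProduct.tmul_add, map_add, hu, hv]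
  | tmul h h' => simp

theorem eq_zero_of_tmul_eq_zero (ε : D →ₗ[k] k) {d : D} (hd : ε d = 1) {v : V}
    (h : v ⊗ₜ[k] d = 0) : v = 0 := by
  simpa [hd] using congrArg (TensorProduct.rid k V ∘ ε.lTensor V) h

end Tensor

section Reduction

variable {k H A N : Type*} [Field k] [Ring H] [HopfAlgebra k H] [Ring A] [Algebra k A]
  [AddCommGroup N] [Module k N] [Module Aᵐᵒᵖ N] [IsScalarTower k Aᵐᵒᵖ N]

/-- The reduction of `A ⊗ H` modulo a two-sided ideal of `A`, valued in the opposite ring. -/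
noncomputable def tensorReduction (k H : Type*) {A : Type*} [Field k] [Ring H] [HopfAlgebra k H]
    [Ring A] [Algebra k A] (Q : TwoSidedIdeal A) :
    A ⊗[k] H →ₗ[k] (Aᵐᵒᵖ ⧸ Q.op.asIdeal) ⊗[k] Hᵐᵒᵖ :=
  TensorProduct.map ((Ideal.Quotient.mkₐ k Q.op.asIdeal).toLinearMap ∘ₗ
    (MulOpposite.opLinearEquiv k).toLinearMap) (MulOpposite.opLinearEquiv k).toLinearMap

theorem tensorReduction_mul (Q : TwoSidedIdeal A) (s t : A ⊗[k] H) :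
    tensorReduction k H Q (s * t) = tensorReduction k H Q t * tensorReduction k H Q s := by
  induction s with
  | zero => simp
  | add x y hx hy => simp only [add_mul, mul_add, map_add, hx, hy]
  | tmul a h =>
    induction t with
    | zero => simp
    | add x y hx hy => simp only [add_mul, mul_add, map_add, hx, hy]
    | tmul b g => simp [tensorReduction]

/-- The pairing of an element of `N ⊗ H` with an `A`-linear map from `N` to `A/Q`. -/
noncomputable def tensorPairing (H : Type*) [Ring H] [HopfAlgebra k H] {Q : TwoSidedIdeal A}
    (u : N →ₗ[Aᵐᵒᵖ] Aᵐᵒᵖ ⧸ Q.op.asIdeal) :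
    N ⊗[k] H →ₗ[k] (Aᵐᵒᵖ ⧸ Q.op.asIdeal) ⊗[k] Hᵐᵒᵖ :=
  TensorProduct.map (u.restrictScalars k) (MulOpposite.opLinearEquiv k).toLinearMap

theorem tensorPairing_tensorRightAct {Q : TwoSidedIdeal A}
    (u : N →ₗ[Aᵐᵒᵖ] Aᵐᵒᵖ ⧸ Q.op.asIdeal) (t : N ⊗[k] H) (s : A ⊗[k] H) :
    tensorPairing H u (tensorRightAct k H A N t s) =
      tensorReduction k H Q s * tensorPairing H u t := by
  induction t with
  | zero => simp
  | add x y hx hy => simp only [mul_add, map_add, LinearMap.add_apply, hx, hy]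
  | tmul m g =>
    induction s with
    | zero => simp
    | add x y hx hy => simp only [add_mul, map_add, hx, hy]
    | tmul a h =>
      simp only [tensorPairing, tensorRightAct, tensorReduction, TensorProduct.map₂_apply_tmul,
        TensorProduct.map_tmul, LinearMap.mk₂_apply, LinearMap.mul_apply', LinearMap.comp_apply,
        LinearMap.restrictScalars_apply, Algebra.TensorProduct.tmul_mul_tmul, map_smul]
      congr 1

/-- This ring embeds in the opposite of `A/Q ⊗ H`, and stable finiteness passes to opposite rings
and subrings. -/
theorem isStablyFiniteRing_quotient_op_tensor (Q : TwoSidedIdeal A)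
    [IsStablyFiniteRing ((A ⧸ Q.asIdeal) ⊗[k] H)] :
    IsStablyFiniteRing ((Aᵐᵒᵖ ⧸ Q.op.asIdeal) ⊗[k] Hᵐᵒᵖ) := by
  let f : Aᵐᵒᵖ →ₐ[k] (A ⧸ Q.asIdeal)ᵐᵒᵖ := AlgHom.op (Ideal.Quotient.mkₐ k Q.asIdeal)
  have hf (x : Aᵐᵒᵖ) : f x = 0 ↔ x ∈ Q.op.asIdeal := by
    rw [TwoSidedIdeal.mem_asIdeal, TwoSidedIdeal.mem_op_iff, ← TwoSidedIdeal.mem_asIdeal,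
      ← Ideal.Quotient.eq_zero_iff_mem, ← MulOpposite.unop_eq_zero_iff]
    rfl
  let g : (Aᵐᵒᵖ ⧸ Q.op.asIdeal) →ₐ[k] (A ⧸ Q.asIdeal)ᵐᵒᵖ :=
    Ideal.Quotient.liftₐ _ f fun a ha => (hf a).mpr ha
  have hg : Function.Injective g := by
    rw [injective_iff_map_eq_zero]
    intro x hx
    obtain ⟨x, rfl⟩ := Ideal.Quotient.mk_surjective x
    exact Ideal.Quotient.eq_zero_iff_mem.mpr ((hf x).mp hx)
  let F : (Aᵐᵒᵖ ⧸ Q.op.asIdeal) ⊗[k] Hᵐᵒᵖ →ₐ[k] ((A ⧸ Q.asIdeal) ⊗[k] H)ᵐᵒᵖ :=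
    (Algebra.TensorProduct.opAlgEquiv k k (A ⧸ Q.asIdeal) H).toAlgHom.comp
      (Algebra.TensorProduct.map g (AlgHom.id k Hᵐᵒᵖ))
  refine IsStablyFiniteRing.of_injective F ?_
  refine (Algebra.TensorProduct.opAlgEquiv k k (A ⧸ Q.asIdeal) H).injective.comp ?_
  exact Module.Flat.rTensor_preserves_injective_linearMap (M := Hᵐᵒᵖ) g.toLinearMap hg

variable [ComoduleAlgebra k H A]

/-- The homomorphism `A → A/Q ⊗ H` induced by the coaction, between opposite rings. -/
noncomputable def coactionReduction (k H : Type*) {A : Type*} [Field k] [Ring H]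
    [HopfAlgebra k H] [Ring A] [Algebra k A] [ComoduleAlgebra k H A] (Q : TwoSidedIdeal A) :
    Aᵐᵒᵖ →+* (Aᵐᵒᵖ ⧸ Q.op.asIdeal) ⊗[k] Hᵐᵒᵖ where
  toFun a := tensorReduction k H Q (coaction k H A a.unop)
  map_zero' := by simp
  map_add' := by simp
  map_one' := by
    rw [MulOpposite.unop_one, coaction, ComoduleAlgebra.coact_one,
      Algebra.TensorProduct.one_def]
    simp [tensorReduction, Algebra.TensorProduct.one_def]
  map_mul' a b := by
    rw [MulOpposite.unop_mul, coaction, ComoduleAlgebra.coact_mul, tensorReduction_mul]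

/-- The kernel of `A → A/Q ⊗ H` is a costable ideal. -/
theorem isCostable_ker_coactionReduction (Q : TwoSidedIdeal A) :
    IsCostable k H (TwoSidedIdeal.ker (coactionReduction k H Q)).unop := by
  intro a ha
  let g := tensorReduction k H Q ∘ₗ coaction k H A
  have hker (b : A) : b ∈ LinearMap.ker g ↔
      b ∈ (TwoSidedIdeal.ker (coactionReduction k H Q)).unop := by
    rw [TwoSidedIdeal.mem_unop_iff, TwoSidedIdeal.mem_ker]; rfl
  have hex := Module.Flat.rTensor_exact H (LinearMap.exact_subtype_ker_map g)
  -- With `π : A → A/Q`, coassociativity turns `(π ⊗ id ⊗ id)(ρ ⊗ id) ρ(a)` into `(id ⊗ Δ)(π ⊗ id)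
  -- ρ(a)`, which vanishes for `a` in the kernel. Flatness of `H` then places `ρ(a)` in `ker g ⊗ H`.
  have h0 : g.rTensor H (coaction k H A a) = 0 := by
    have h1 := rTensor_map_comp_assoc_symm_comp_lTensor (Coalgebra.comul (R := k) (A := H))
      ((Ideal.Quotient.mkₐ k Q.op.asIdeal).toLinearMap ∘ₗ
        (MulOpposite.opLinearEquiv k).toLinearMap) (MulOpposite.opLinearEquiv k)
    have h2 := (TensorProduct.assoc k A H H).symm_apply_apply
      ((coaction k H A).rTensor H (coaction k H A a))
    rw [assoc_rTensor_coaction] at h2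
    rw [LinearMap.rTensor_comp, LinearMap.comp_apply, ← h2]
    refine (LinearMap.congr_fun h1 _).trans ?_
    have h3 : tensorReduction k H Q (coaction k H A a) = 0 := (hker a).mpr ha
    rw [tensorReduction] at h3
    rw [LinearMap.comp_apply, h3]
    exact LinearMap.map_zero _
  obtain ⟨t, ht⟩ := (hex _).mp h0
  change coaction k H A a ∈ _
  rw [← ht]
  clear ht
  induction t with
  | zero => simp
  | add x y hx hy => rw [map_add]; exact add_mem hx hy
  | tmul b h => exact Submodule.subset_span ⟨b, (hker b).mp b.2, h, rfl⟩

/-- The kernel is costable, hence zero or everything. It is proper because `1` goes to `1 ⊗ 1`, and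
`ε(1) = 1` shows that this is nonzero when `A/Q` is. -/
theorem coactionReduction_injective (hA : IsHSimple k H A) {Q : TwoSidedIdeal A}
    (hQ : IsCoatom Q) : Function.Injective (coactionReduction k H Q) := by
  have hbot : (TwoSidedIdeal.ker (coactionReduction k H Q)).unop = ⊥ := by
    refine (hA _ (isCostable_ker_coactionReduction Q)).resolve_right fun htop => hQ.1 ?_
    have h1 : coactionReduction k H Q 1 = 0 := by
      rw [← TwoSidedIdeal.mem_ker, ← MulOpposite.op_one, ← TwoSidedIdeal.mem_unop_iff, htop]
      exact TwoSidedIdeal.mem_top _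
    rw [map_one, Algebra.TensorProduct.one_def] at h1
    have h3 : (1 : Aᵐᵒᵖ ⧸ Q.op.asIdeal) = 0 :=
      eq_zero_of_tmul_eq_zero (Coalgebra.counit (R := k) (A := H) ∘ₗ
        (MulOpposite.opLinearEquiv k).symm.toLinearMap) (by simp) h1
    have h4 : (1 : Aᵐᵒᵖ) ∈ Q.op.asIdeal := Ideal.Quotient.eq_zero_iff_mem.mp h3
    rw [TwoSidedIdeal.mem_asIdeal, TwoSidedIdeal.mem_op_iff, MulOpposite.unop_one] at h4
    exact eq_top_iff.mpr fun y _ => by simpa using Q.mul_mem_left y 1 h4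
  rw [injective_iff_map_eq_zero]
  intro a ha
  have h : a.unop ∈ (TwoSidedIdeal.ker (coactionReduction k H Q)).unop := by
    rw [TwoSidedIdeal.mem_unop_iff, TwoSidedIdeal.mem_ker]; exact ha
  rw [hbot, TwoSidedIdeal.mem_bot] at h
  exact MulOpposite.unop_injective h

/-! ### The antipode and bases of powers of Hopf modules -/

section Freeness

variable [RightHopfModule k H A N] {Q : TwoSidedIdeal A}

theorem tensorPairing_coaction_smul (u : N →ₗ[Aᵐᵒᵖ] Aᵐᵒᵖ ⧸ Q.op.asIdeal) (a : Aᵐᵒᵖ) (y : N) :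
    tensorPairing H u (coaction k H N (a • y)) =
      coactionReduction k H Q a * tensorPairing H u (coaction k H N y) := by
  rw [← MulOpposite.op_unop a, coaction_op_smul, tensorPairing_tensorRightAct]
  rfl

/-- The map `y ⊗ g ↦ (1 ⊗ S(g) h) û(y)`, where `û` is the map induced by `u`. -/
noncomputable def antipodePairing (u : N →ₗ[Aᵐᵒᵖ] Aᵐᵒᵖ ⧸ Q.op.asIdeal) (h : H) :
    N ⊗[k] H →ₗ[k] (Aᵐᵒᵖ ⧸ Q.op.asIdeal) ⊗[k] Hᵐᵒᵖ :=
  TensorProduct.lift ((LinearMap.mul k _).flip.compl₁₂ (tensorPairing H u ∘ₗ coaction k H N)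
    (TensorProduct.mk k (Aᵐᵒᵖ ⧸ Q.op.asIdeal) Hᵐᵒᵖ 1 ∘ₗ
      (MulOpposite.opLinearEquiv k).toLinearMap ∘ₗ LinearMap.mulRight k h ∘ₗ
      HopfAlgebra.antipode k))

theorem antipodePairing_tmul (u : N →ₗ[Aᵐᵒᵖ] Aᵐᵒᵖ ⧸ Q.op.asIdeal) (h : H) (y : N) (g : H) :
    antipodePairing u h (y ⊗ₜ[k] g) =
      (1 ⊗ₜ[k] MulOpposite.op (HopfAlgebra.antipode k g * h)) *
        tensorPairing H u (coaction k H N y) := rfl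

/-- In Sweedler notation the left side is `∑ u(y₀) ⊗ y₁ S(y₂) h`, which collapses by the antipode
and counit axioms. Thus `u(y) ⊗ h` lies in the span of the values of `û` over `A/Q ⊗ H`. -/
theorem antipodePairing_coaction (u : N →ₗ[Aᵐᵒᵖ] Aᵐᵒᵖ ⧸ Q.op.asIdeal) (h : H) (y : N) :
    antipodePairing u h (coaction k H N y) = u y ⊗ₜ[k] MulOpposite.op h := by
  let η : H ⊗[k] H →ₗ[k] Hᵐᵒᵖ := (MulOpposite.opLinearEquiv k).toLinearMap ∘ₗ
    LinearMap.mulRight k h ∘ₗ LinearMap.mul' k H ∘ₗ (HopfAlgebra.antipode k).lTensor H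
  have h1 : antipodePairing u h = TensorProduct.map (u.restrictScalars k) η ∘ₗ
      (TensorProduct.assoc k N H H).toLinearMap ∘ₗ (coaction k H N).rTensor H := by
    ext y g
    simp only [TensorProduct.AlgebraTensorModule.curry_apply, TensorProduct.curry_apply,
      LinearMap.coe_restrictScalars, LinearMap.comp_apply, antipodePairing_tmul,
      LinearMap.rTensor_tmul]
    generalize coaction k H N y = t
    induction t with
    | zero => simp
    | add u v hu hv => simp only [TensorProduct.add_tmul, mul_add, map_add, hu, hv]
    | tmul n g' => simp [tensorPairing, η, mul_assoc]
  have h2 : η ∘ₗ Coalgebra.comul (R := k) = (Coalgebra.counit (R := k) (A := H)).smulRight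
      (MulOpposite.op h) := by
    ext g
    have := LinearMap.congr_fun (HopfAlgebra.mul_antipode_lTensor_comul (R := k) (A := H)) g
    simp only [LinearMap.comp_apply, Algebra.linearMap_apply] at this
    simp [η, this, Algebra.smul_def, ← MulOpposite.op_mul, Algebra.commutes]
  have h3 : TensorProduct.map (u.restrictScalars k) η ∘ₗ Coalgebra.comul.lTensor N =
      (TensorProduct.mk k (Aᵐᵒᵖ ⧸ Q.op.asIdeal) Hᵐᵒᵖ).flip (MulOpposite.op h) ∘ₗ
      u.restrictScalars k ∘ₗ (TensorProduct.rid k N).toLinearMap ∘ₗ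
      (Coalgebra.counit (R := k) (A := H)).lTensor N := by
    rw [LinearMap.map_comp_lTensor, h2]
    ext n g
    simp
  rw [h1]
  simp only [LinearMap.comp_apply, LinearEquiv.coe_coe]
  rw [assoc_rTensor_coaction]
  refine (LinearMap.congr_fun h3 _).trans ?_
  simp only [LinearMap.comp_apply, LinearEquiv.coe_coe, rid_lTensor_counit_coaction]
  rfl

/-- Generators of a power of a Hopf module whose number is the rank of a free quotient of the
power over `A/Q` form a basis. -/
theorem linearIndependent_of_span_eq_top (hA : IsHSimple k H A) (hQ : IsCoatom Q)
    [IsStablyFiniteRing ((A ⧸ Q.asIdeal) ⊗[k] H)] {d n : ℕ}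
    (e : (Fin d → N) →ₗ[Aᵐᵒᵖ] (Fin n → Aᵐᵒᵖ ⧸ Q.op.asIdeal)) (he : Function.Surjective e)
    {m : Fin n → Fin d → N} (hm : Submodule.span Aᵐᵒᵖ (Set.range m) = ⊤) :
    LinearIndependent Aᵐᵒᵖ m := by
  have := isStablyFiniteRing_quotient_op_tensor (k := k) (H := H) Q
  let S := (Aᵐᵒᵖ ⧸ Q.op.asIdeal) ⊗[k] Hᵐᵒᵖ
  -- The matrix entries of `e`. Only `N` needs a coaction: `f` applies the pairing with each entry
  -- componentwise.
  let u (i : Fin d) (j : Fin n) : N →ₗ[Aᵐᵒᵖ] Aᵐᵒᵖ ⧸ Q.op.asIdeal :=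
    LinearMap.proj j ∘ₗ e ∘ₗ LinearMap.single Aᵐᵒᵖ (fun _ => N) i
  let f : (Fin d → N) →ₛₗ[coactionReduction k H Q] (Fin n → S) :=
    { toFun := fun x j => ∑ i, tensorPairing H (u i j) (coaction k H N (x i))
      map_add' := fun x y => by
        funext j
        simp only [Pi.add_apply, map_add, Finset.sum_add_distrib]
      map_smul' := fun a x => by
        funext j
        simp only [Pi.smul_apply, tensorPairing_coaction_smul, Finset.mul_sum, smul_eq_mul] }
  have hf (i : Fin d) (y : N) (j : Fin n) :
      f (Pi.single i y) j = tensorPairing H (u i j) (coaction k H N y) := by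
    change ∑ i', tensorPairing H (u i' j) (coaction k H N (Pi.single (M := fun _ => N) i y i')) = _
    rw [Finset.sum_eq_single i (fun i' _ hi' => by rw [Pi.single_eq_of_ne hi', map_zero, map_zero])
      (by simp), Pi.single_eq_same]
  refine linearIndependent_of_semilinear (coactionReduction_injective hA hQ) hm f ?_
  -- To see that the values of `f` span `S^n`, the antipode identity first produces the vectors with
  -- entries `e(x)_j ⊗ h`; surjectivity of `e` then yields all vectors supported at one coordinate.
  have h1 (i : Fin d) (h : H) (t : N ⊗[k] H) :
      (fun j => antipodePairing (u i j) h t) ∈ Submodule.span S (Set.range f) := by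
    induction t with
    | zero => simp only [map_zero]; exact zero_mem _
    | add x y hx hy => simp only [map_add]; exact add_mem hx hy
    | tmul y g =>
      convert Submodule.smul_mem (Submodule.span S (Set.range f))
        (1 ⊗ₜ[k] MulOpposite.op (HopfAlgebra.antipode k g * h) : S)
        (Submodule.subset_span ⟨Pi.single i y, rfl⟩) using 1
      funext j
      rw [antipodePairing_tmul, Pi.smul_apply, hf, smul_eq_mul]
  have h2 (x : Fin d → N) (h : H) :
      (fun j => (e x j ⊗ₜ[k] MulOpposite.op h : S)) ∈ Submodule.span S (Set.range f) := by
    have := Submodule.sum_mem (Submodule.span S (Set.range f)) (t := Finset.univ)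
      fun i _ => h1 i h (coaction k H N (x i))
    convert this using 1
    funext j
    rw [Finset.sum_apply]
    simp only [antipodePairing_coaction, ← TensorProduct.sum_tmul]
    congr 1
    simp only [u, LinearMap.comp_apply, LinearMap.proj_apply]
    rw [← Finset.sum_apply, ← map_sum]
    exact congrArg (fun z => e z j) (Finset.univ_sum_single x).symm
  have h3 (j : Fin n) (w : S) : Pi.single j w ∈ Submodule.span S (Set.range f) := by
    induction w using TensorProduct.induction_on with
    | zero => rw [Pi.single_zero]; exact zero_mem _
    | add x y hx hy => rw [Pi.single_add]; exact add_mem hx hy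
    | tmul c h =>
      obtain ⟨x, hx⟩ := he (Pi.single j c)
      convert h2 x h.unop using 1
      funext j'
      rw [hx]
      by_cases hj : j' = j
      · subst hj; simp
      · simp [Pi.single_eq_of_ne hj]
  rw [eq_top_iff]
  intro w _
  rw [← Finset.univ_sum_single w]
  exact sum_mem fun j _ => h3 j (w j)

end Freeness

end Reduction

/-! ### Freeness of infinite direct sums -/

/-- An infinite direct sum of finite projective modules which are nonzero modulo every member of a
semilocal family is free. -/
theorem IsSemilocalFamily.nonempty_linearEquiv_finsupp {B ι M κ : Type*} [Ring B] [Finite ι]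
    {P : ι → TwoSidedIdeal B} (h : IsSemilocalFamily P) [AddCommGroup M] [Module B M]
    [Module.Projective B M] [Infinite κ] (N : κ → Submodule B M) (hind : iSupIndep N)
    (htop : iSup N = ⊤) (hfg : ∀ t, (N t).FG) (hproj : ∀ t, Module.Projective B (N t))
    (hlen : ∀ i t, 1 ≤ lengthModulo (P i).asIdeal (N t)) : Nonempty (M ≃ₗ[B] (κ →₀ B)) := by
  classical
  obtain ⟨D, hD, hsurj⟩ := h.exists_surjective_pi
  have hfin (t) : Module.Finite B (N t) := Module.Finite.iff_fg.mpr (hfg t)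
  -- The summands are regrouped into `κ` blocks of `D`. Each block maps onto `B`, so `M` maps onto
  -- the free module on `κ`.
  obtain ⟨c⟩ : Nonempty (κ ≃ κ × Fin D) := by
    refine Cardinal.eq.mp ?_
    rw [Cardinal.mk_prod, Cardinal.mk_fin, Cardinal.lift_natCast, Cardinal.lift_uzero,
      Cardinal.mul_eq_left (Cardinal.aleph0_le_mk κ)
        (Cardinal.natCast_lt_aleph0.le.trans (Cardinal.aleph0_le_mk κ))
        (Nat.cast_ne_zero.mpr hD.ne')]
  obtain ⟨c'⟩ : Nonempty (κ ≃ κ × ℕ) := Cardinal.eq.mp (by rw [Cardinal.mk_prod]; simp)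
  let N' (p : κ × Fin D) : Submodule B M := N (c.symm p)
  have hind' : iSupIndep N' := hind.comp c.symm.injective
  have htop' : iSup N' = ⊤ := (c.symm.iSup_comp (g := N)).trans htop
  let E := LinearEquiv.ofBijective (DirectSum.coeLinearMap N')
    (DirectSum.isInternal_submodule_of_iSupIndep_of_iSup_eq_top hind' htop')
  have hf (t : κ) := hsurj (fun j => N' (t, j)) fun i j => hlen i _
  choose f hf using hf
  let q : (DirectSum (κ × Fin D) fun p => N' p) →ₗ[B] (κ →₀ B) :=
    DirectSum.toModule B _ _ fun p =>
      Finsupp.lsingle p.1 ∘ₗ f p.1 ∘ₗ LinearMap.single B (fun j => N' (p.1, j)) p.2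
  have hq : Function.Surjective q := by
    rw [← LinearMap.range_eq_top, eq_top_iff]
    intro w _
    induction w using Finsupp.induction_linear with
    | zero => exact zero_mem _
    | add x y hx hy => exact add_mem (hx trivial) (hy trivial)
    | single t b =>
      obtain ⟨z, rfl⟩ := hf t b
      refine ⟨∑ j, DirectSum.lof B (κ × Fin D) (fun p => N' p) (t, j) (z j), ?_⟩
      rw [map_sum]
      simp only [q, DirectSum.toModule_lof, LinearMap.comp_apply]
      have hz : ∑ j, LinearMap.single B (fun j => N' (t, j)) j (z j) = z :=
        Finset.univ_sum_single z
      rw [← map_sum, ← map_sum (f t), hz]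
      rfl
  -- Padding finite generating families with zeros gives every summand a sequence of generators, so
  -- `M` is an image of the free module on `κ × ℕ`, that is, on `κ`.
  have hx (t : κ) : ∃ x : ℕ → M, Submodule.span B (Set.range x) = N t := by
    obtain ⟨n, s, hs⟩ := Submodule.fg_iff_exists_fin_generating_family.mp (hfg t)
    refine ⟨fun j => if hj : j < n then s ⟨j, hj⟩ else 0, ?_⟩
    rw [← hs]
    apply le_antisymm <;> rw [Submodule.span_le]
    · rintro _ ⟨j, rfl⟩
      by_cases hj : j < n
      · simp only [hj, dif_pos]; exact Submodule.subset_span ⟨_, rfl⟩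
      · simp only [hj, dif_neg, not_false_eq_true]; exact zero_mem _
    · rintro _ ⟨j, rfl⟩
      exact Submodule.subset_span ⟨j, by simp⟩
  choose x hx using hx
  let p := Finsupp.linearCombination B (fun r : κ × ℕ => x r.1 r.2) ∘ₗ
    (Finsupp.domLCongr c' : (κ →₀ B) ≃ₗ[B] _).toLinearMap
  have hp : Function.Surjective p := by
    have hE := (Finsupp.domLCongr c' : (κ →₀ B) ≃ₗ[B] (κ × ℕ →₀ B)).surjective
    refine Function.Surjective.comp (g := Finsupp.linearCombination B _) ?_ hE
    rw [← LinearMap.range_eq_top, Finsupp.range_linearCombination, eq_top_iff, ← htop, iSup_le_iff]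
    intro t
    rw [← hx t]
    exact Submodule.span_mono (by rintro _ ⟨j, rfl⟩; exact ⟨(t, j), rfl⟩)
  exact nonempty_linearEquiv_finsupp_of_surjective p hp (q ∘ₗ E.symm.toLinearMap)
    (hq.comp E.symm.surjective)

/-! ### Decomposition of Hopf modules -/

theorem sSupIndep_insert {α : Type*} [CompleteLattice α] [IsModularLattice α] {s : Set α} {a : α}
    (hs : sSupIndep s) (ha : Disjoint (sSup s) a) : sSupIndep (insert a s) := by
  intro x hx
  by_cases hxa : x = a
  · subst hxa
    exact ha.symm.mono_right (sSup_le_sSup fun y hy => hy.1.resolve_left hy.2)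
  · have hxs : x ∈ s := hx.resolve_left hxa
    rw [Set.insert_sdiff_of_notMem _ (fun h => hxa (Set.mem_singleton_iff.mp h).symm), sSup_insert,
      sup_comm]
    refine (hs hxs).disjoint_sup_right_of_disjoint_sup_left (ha.mono_left ?_)
    exact sup_le (le_sSup hxs) (sSup_le_sSup Set.sdiff_subset)

/-- Some power with positive exponent of the module is free of finite rank. -/
def HasFreePower (B N : Type*) [Ring B] [AddCommGroup N] [Module B N] : Prop :=
  ∃ d n : ℕ, 0 < d ∧ Nonempty ((Fin d → N) ≃ₗ[B] (Fin n → B))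

theorem HasFreePower.congr {B N N' : Type*} [Ring B] [AddCommGroup N] [Module B N]
    [AddCommGroup N'] [Module B N'] (h : HasFreePower B N) (e : N ≃ₗ[B] N') :
    HasFreePower B N' := by
  obtain ⟨d, n, hd, ⟨f⟩⟩ := h
  exact ⟨d, n, hd, ⟨(LinearEquiv.piCongrRight fun _ => e.symm) ≪≫ₗ f⟩⟩

theorem HasFreePower.projective {B N : Type*} [Ring B] [AddCommGroup N] [Module B N]
    (h : HasFreePower B N) : Module.Projective B N := by
  obtain ⟨d, n, hd, ⟨f⟩⟩ := h
  have : Module.Projective B (Fin d → N) := .of_equiv' f.symm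
  exact .of_split (LinearMap.single B (fun _ : Fin d => N) ⟨0, hd⟩) (LinearMap.proj ⟨0, hd⟩)
    (by ext; simp)

theorem nonempty_linearEquiv_of_linearIndependent {B X : Type*} [Ring B] [AddCommGroup X]
    [Module B X] {n : ℕ} (g : (Fin n → B) →ₗ[B] X) (hg : Function.Surjective g)
    (h : ∀ m : Fin n → X, Submodule.span B (Set.range m) = ⊤ → LinearIndependent B m) :
    Nonempty (X ≃ₗ[B] (Fin n → B)) := by
  have hspan : Submodule.span B (Set.range fun j => g (Pi.basisFun B (Fin n) j)) = ⊤ := by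
    rw [Set.range_comp', Submodule.span_image, (Pi.basisFun B (Fin n)).span_eq, Submodule.map_top,
      LinearMap.range_eq_top.mpr hg]
  exact ⟨(Module.Basis.mk (h _ hspan) hspan.ge).equivFun⟩

section HopfModule

variable {k H A : Type*} [Field k] [Ring H] [HopfAlgebra k H] [Ring A] [Algebra k A]
  [ComoduleAlgebra k H A] {n : ℕ} {Q : Fin n → TwoSidedIdeal A}
  (M : Type*) [AddCommGroup M] [Module k M] [Module Aᵐᵒᵖ M] [IsScalarTower k Aᵐᵒᵖ M]
  [RightHopfModule k H A M]

/-- The length comparison chooses the maximal ideal at which weak finiteness is applied; it depends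
on `M`, so condition (C) is needed at every maximal ideal. -/
theorem hasFreePower_of_rightHopfModule [Nontrivial A] (hfam : IsSemilocalFamily fun i => (Q i).op)
    (hQ : ∀ i, IsCoatom (Q i)) (hA : IsHSimple k H A) (hC : ConditionC k H A)
    [Module.Finite Aᵐᵒᵖ M] : HasFreePower Aᵐᵒᵖ M := by
  have := hfam.nonempty
  obtain ⟨i, d, m, hd, ⟨g, hg⟩, ⟨e, he⟩⟩ := hfam.exists_surjective_fun M
  have := hC (Q i) (hQ i)
  exact ⟨d, m, hd, nonempty_linearEquiv_of_linearIndependent g hg fun _ hm =>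
    linearIndependent_of_span_eq_top hA (hQ i) e he hm⟩

/-- A free power forces the length ratio to be constant, so the rank of the given free reduction is
also a sufficient number of generators of `M`. The basis criterion then applies to the first power
of `M`. -/
theorem free_of_isFreeModulo [Nontrivial A] (hfam : IsSemilocalFamily fun i => (Q i).op)
    (hQ : ∀ i, IsCoatom (Q i)) (hA : IsHSimple k H A) (hC : ConditionC k H A)
    [Module.Finite Aᵐᵒᵖ M] (i : Fin n) (hfree : IsFreeModulo M (Q i)) :
    Module.Free Aᵐᵒᵖ M := by
  obtain ⟨d, m, hd, ⟨g⟩⟩ := hasFreePower_of_rightHopfModule M hfam hQ hA hC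
  have := hfam.isSimpleRing i
  have : Module.Free (Aᵐᵒᵖ ⧸ (Q i).op.asIdeal)
    (M ⧸ ((Q i).op.asIdeal • ⊤ : Submodule Aᵐᵒᵖ M)) := hfree
  have : Module.Finite (Aᵐᵒᵖ ⧸ (Q i).op.asIdeal) (M ⧸ ((Q i).op.asIdeal • ⊤ : Submodule Aᵐᵒᵖ M)) :=
    Module.Finite.of_restrictScalars_finite Aᵐᵒᵖ _ _
  let b := Module.Free.chooseBasis (Aᵐᵒᵖ ⧸ (Q i).op.asIdeal)
    (M ⧸ ((Q i).op.asIdeal • ⊤ : Submodule Aᵐᵒᵖ M))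
  let e := (b.reindex (Fintype.equivFin _)).equivFun.restrictScalars Aᵐᵒᵖ
  obtain ⟨f, hf⟩ := hfam.exists_surjective_of_equiv_quotient hd g i e
  let c : M ≃ₗ[Aᵐᵒᵖ] (Fin 1 → M) := (LinearEquiv.funUnique (Fin 1) Aᵐᵒᵖ M).symm
  have := hC (Q i) (hQ i)
  obtain ⟨F⟩ := nonempty_linearEquiv_of_linearIndependent (c.toLinearMap ∘ₗ f)
    (c.surjective.comp hf) fun _ hm => linearIndependent_of_span_eq_top hA (hQ i)
      (e.toLinearMap ∘ₗ Submodule.mkQ _ ∘ₗ c.symm.toLinearMap)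
      (e.surjective.comp ((Submodule.mkQ_surjective _).comp c.symm.surjective)) hm
  exact .of_equiv (c ≪≫ₗ F).symm

/-- A Hopf module is a direct sum of finite submodules with free powers. -/
theorem exists_sSupIndep_hasFreePower [Nontrivial A]
    (hfam : IsSemilocalFamily fun i => (Q i).op)
    (hQ : ∀ i, IsCoatom (Q i)) (hA : IsHSimple k H A) (hC : ConditionC k H A) :
    ∃ T : Set (Submodule Aᵐᵒᵖ M), sSupIndep T ∧ sSup T = ⊤ ∧
      ∀ N ∈ T, N ≠ ⊥ ∧ N.FG ∧ HasFreePower Aᵐᵒᵖ N := by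
  -- Only the total sum is required to be a Hopf submodule, not the individual members of the
  -- family.
  obtain ⟨T, hT⟩ := zorn_subset {T : Set (Submodule Aᵐᵒᵖ M) | sSupIndep T ∧
      IsHopfSubmodule k H (sSup T) ∧ ∀ N ∈ T, N ≠ ⊥ ∧ N.FG ∧ HasFreePower Aᵐᵒᵖ N}
    fun c hc hchain => ⟨⋃₀ c, ⟨iSupIndep_sUnion_of_directed hchain.directedOn
      fun s hs => (hc hs).1, by
        rw [sSup_sUnion, ← sSup_image]
        exact IsHopfSubmodule.sSup _ (by rintro _ ⟨s, hs, rfl⟩; exact (hc hs).2.1),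
      fun N ⟨s, hs, hN⟩ => (hc hs).2.2 N hN⟩, fun _ => Set.subset_sUnion_of_mem⟩
  obtain ⟨hind, hL, hgood⟩ := hT.prop
  refine ⟨T, hind, ?_, hgood⟩
  set L := sSup T with hLdef
  by_contra hne
  obtain ⟨x, -, hx⟩ := SetLike.exists_of_lt (lt_top_iff_ne_top.mpr hne)
  let := hL.rightHopfModuleQuotient
  obtain ⟨K, hKfg, hK, hxK⟩ := exists_isHopfSubmodule_mem (k := k) (H := H) (A := A) (L.mkQ x)
  let := hK.rightHopfModule
  have : Module.Finite Aᵐᵒᵖ K := Module.Finite.iff_fg.mpr hKfg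
  have hpow : HasFreePower Aᵐᵒᵖ K := hasFreePower_of_rightHopfModule K hfam hQ hA hC
  have := hpow.projective
  -- The lift `s` of the inclusion of `K` is linear but need not respect the coactions, so its range
  -- may fail to be a Hopf submodule. The sum of `L` and the range is still one, being the preimage
  -- of `K`.
  obtain ⟨s, hs⟩ := Module.projective_lifting_property L.mkQ K.subtype L.mkQ_surjective
  have hs' (z : K) : L.mkQ (s z) = z := LinearMap.congr_fun hs z
  have hsinj : Function.Injective s := fun z w hzw => Subtype.ext (by rw [← hs', ← hs', hzw])
  have hdisj : Disjoint L (LinearMap.range s) := by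
    rw [Submodule.disjoint_def]
    rintro _ hy ⟨z, rfl⟩
    have : z = 0 := Subtype.ext (by
      rw [← hs']; exact (Submodule.Quotient.mk_eq_zero _).mpr hy)
    rw [this, map_zero]
  have hsup : sSup (insert (LinearMap.range s) T) = K.comap L.mkQ := by
    rw [sSup_insert, ← hLdef]
    apply le_antisymm
    · refine sup_le ?_ fun y hy => ?_
      · rintro _ ⟨z, rfl⟩
        rw [Submodule.mem_comap, hs']
        exact z.2
      · rw [Submodule.mem_comap, (L.mkQ_apply y).trans ((Submodule.Quotient.mk_eq_zero _).mpr hy)]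
        exact zero_mem _
    · intro y hy
      rw [← add_sub_cancel (s ⟨L.mkQ y, hy⟩) y]
      refine Submodule.add_mem_sup ⟨_, rfl⟩ ?_
      rw [← Submodule.Quotient.mk_eq_zero, ← Submodule.mkQ_apply, map_sub, hs', sub_self]
  have hrange : LinearMap.range s ≠ ⊥ := by
    rw [Ne, LinearMap.range_eq_bot]
    rintro rfl
    have := hs' ⟨L.mkQ x, hxK⟩
    rw [LinearMap.zero_apply, map_zero] at this
    exact hx ((Submodule.Quotient.mk_eq_zero _).mp this.symm)
  -- By maximality the new summand already belongs to the family, hence lies in `L`, although it is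
  -- nonzero and disjoint from `L`.
  have hmem : LinearMap.range s ∈ T := by
    refine hT.le_of_ge ⟨sSupIndep_insert hind hdisj, ?_, ?_⟩ (Set.subset_insert _ _)
      (Set.mem_insert _ _)
    · rw [hsup]; exact hL.comap_mkQ K hK
    · rintro N (rfl | hN)
      · exact ⟨hrange, Module.Finite.iff_fg.mp (Module.Finite.range s),
          hpow.congr (LinearEquiv.ofInjective s hsinj)⟩
      · exact hgood N hN
  exact hrange (disjoint_self.mp (hdisj.mono_left (le_sSup hmem)))

end HopfModule

/-! ### Conclusion -/

theorem isFreeModulo_of_free {A : Type*} [Ring A] (M : Type*) [AddCommGroup M] [Module Aᵐᵒᵖ M]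
    [Module.Free Aᵐᵒᵖ M] (Q : TwoSidedIdeal A) : IsFreeModulo M Q := by
  let I := Q.op.asIdeal
  let b := Module.Free.chooseBasis Aᵐᵒᵖ M
  let f : M →ₗ[Aᵐᵒᵖ] (Module.Free.ChooseBasisIndex Aᵐᵒᵖ M →₀ Aᵐᵒᵖ ⧸ I) :=
    Finsupp.mapRange.linearMap (Submodule.mkQ I) ∘ₗ b.repr.toLinearMap
  have hf : Function.Surjective f :=
    (Finsupp.mapRange_surjective _ (map_zero _) (Submodule.mkQ_surjective I)).comp b.repr.surjective
  have hker : LinearMap.ker f = I • ⊤ := by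
    apply le_antisymm
    · intro m hm
      rw [← b.linearCombination_repr m, Finsupp.linearCombination_apply]
      refine Submodule.sum_mem _ fun i _ => Submodule.smul_mem_smul ?_ trivial
      exact (Submodule.Quotient.mk_eq_zero I).mp (DFunLike.congr_fun (LinearMap.mem_ker.mp hm) i)
    · rw [Submodule.smul_le]
      intro a ha m _
      rw [LinearMap.mem_ker]
      ext i
      exact (Submodule.Quotient.mk_eq_zero I).mpr (by
        rw [LinearEquiv.coe_coe, map_smul]; exact I.mul_mem_right _ ha)
  let e := Submodule.quotEquivOfEq _ _ hker.symm ≪≫ₗ f.quotKerEquivOfSurjective hf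
  let e' : (M ⧸ (I • ⊤ : Submodule Aᵐᵒᵖ M)) ≃ₗ[Aᵐᵒᵖ ⧸ I]
      (Module.Free.ChooseBasisIndex Aᵐᵒᵖ M →₀ Aᵐᵒᵖ ⧸ I) :=
    { e with
      map_smul' := fun c m => by
        obtain ⟨c, rfl⟩ := Ideal.Quotient.mk_surjective c
        exact e.map_smul c m }
  exact Module.Free.of_equiv e'.symm

theorem theorem3p5 {k H A : Type*} [Field k] [Ring H] [HopfAlgebra k H]
    [Ring A] [Algebra k A] [ComoduleAlgebra k H A] [Nontrivial A]
    (hlocal : IsSemilocal A) (hsimple : IsHSimple k H A) (hC : ConditionC k H A)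
    (M : Type*) [AddCommGroup M] [Module k M] [Module Aᵐᵒᵖ M] [IsScalarTower k Aᵐᵒᵖ M]
    [RightHopfModule k H A M] :
    Module.Projective Aᵐᵒᵖ M ∧
      (Module.Free Aᵐᵒᵖ M ↔ ∃ Q : TwoSidedIdeal A, IsCoatom Q ∧ IsFreeModulo M Q) := by
  classical
  obtain ⟨n, Q, hfam, hcoatom⟩ := hlocal.exists_isSemilocalFamily
  have hQ (i : Fin n) : IsCoatom (Q i) := (hcoatom _).mpr ⟨i, rfl⟩
  obtain ⟨T, hind, htop, hT⟩ := exists_sSupIndep_hasFreePower M hfam hQ hsimple hC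
  have hind' : iSupIndep fun N : T => N.1 := (sSupIndep_iff T).mp hind
  have htop' : ⨆ N : T, N.1 = ⊤ := by rw [← sSup_eq_iSup', htop]
  have hproj (N : T) : Module.Projective Aᵐᵒᵖ N.1 := (hT N.1 N.2).2.2.projective
  let E := LinearEquiv.ofBijective (DirectSum.coeLinearMap fun N : T => N.1)
    (DirectSum.isInternal_submodule_of_iSupIndep_of_iSup_eq_top hind' htop')
  have hM : Module.Projective Aᵐᵒᵖ M := .of_equiv' E
  refine ⟨hM, fun _ => ?_, ?_⟩
  · obtain ⟨i⟩ := hfam.nonempty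
    exact ⟨Q i, hQ i, isFreeModulo_of_free M (Q i)⟩
  · rintro ⟨Q', hQ', hfree⟩
    obtain ⟨i, rfl⟩ := (hcoatom Q').mp hQ'
    -- The assumption on `M/MQ'` matters only for finite `T`. For infinite `T` each summand, being
    -- nonzero with a free power, survives modulo every maximal ideal, and the sum is free
    -- regardless.
    obtain _ | _ := finite_or_infinite T
    · have : Module.Finite Aᵐᵒᵖ M := by
        rw [Module.finite_def, ← htop']
        exact Submodule.fg_iSup _ fun N => (hT N.1 N.2).2.1
      exact free_of_isFreeModulo M hfam hQ hsimple hC i hfree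
    · have hlen (i : Fin n) (N : T) : 1 ≤ lengthModulo (Q i).op.asIdeal N.1 := by
        obtain ⟨hne, -, d, m, hd, ⟨g⟩⟩ := hT N.1 N.2
        have := Submodule.nontrivial_iff_ne_bot.mpr hne
        exact hfam.one_le_lengthModulo hd g i
      obtain ⟨F⟩ := hfam.nonempty_linearEquiv_finsupp (fun N : T => N.1) hind' htop'
        (fun N => (hT N.1 N.2).2.1) hproj hlen
      exact .of_equiv F.symm
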